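/- **Setting.** Let $A,E\in\mathbb C^{n\times n}$, $B\in\mathbb C^{n\times m}$, $C\in\mathbb C^{p\times n}$, $D\in\mathbb C^{p\times m}$ with $n\ge 1$ and $E$ invertible, let $\|\cdot\|$ be the spectral norm, and let $\varepsilon>0$ satisfy $\varepsilon\|D\|<1$. Write $\sigma(M,N)=\{z\in\mathbb C:\det(zN-M)=0\}$, $M(\Delta)=A+B\Delta(I-D\Delta)^{-1}C$, $$\sigma_\varepsilon=\bigcup\{\sigma(M(\Delta),E):\Delta\in\mathbb C^{m\times p},\ \|\Delta\|\le\varepsilon\},\qquad \alpha_\varepsilon=\max_{z\in\sigma_\varepsilon}\operatorname{Re}z,\qquad \rho_\varepsilon=\max_{z\in\sigma_\varepsilon}|z| .$$ Let $G(z)=C(zE-A)^{-1}B+D$, and let $g(z)\in[0,\infty]$ be $\|G(z)\|$, extended to the points of $\sigma(A,E)$ by its limit ($g=\infty$ exactly at the poles of $G$). With $\gamma=\varepsilon^{-1}$, $R=D^*D-\gamma^2I$, $S=DD^*-\gamma^2I$, $\hat A=A-BR^{-1}D^*C$ put $$\mathcal M_x=\begin{bmatrix}\hat A-xE&-\gamma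 BR^{-1}B^*\\ \gamma C^*S^{-1}C&-(\hat A-xE)^*\end{bmatrix},\ \mathcal N=\begin{bmatrix}E&0\\0&E^*\end{bmatrix},\quad \mathcal S_r=\begin{bmatrix}\hat A&-\gamma BR^{-1}B^*\\0&rE^*\end{bmatrix},\ \mathcal T_r=\begin{bmatrix}rE&0\\-\gamma C^*S^{-1}C&\hat A^*\end{bmatrix}.$$ **Selection of eigenvalues.** Let $\Lambda\subseteq\sigma(A,E)$ be chosen by the user so that every eigenvalue left out is uncontrollable ($B^*y=0$ for some $y\neq0$ with $y^*A=\lambda y^*E$) or unobservable ($Cx=0$ for some $x\ne0$ with $Ax=\lambda Ex$), and is not a pole of $G$. **fastSearch.** Let $f_\psi:\mathbb R\to(-\infty,\infty]$ be given for each $\psi\in\mathbb R$. Given $x\in\mathbb R$ and a finite set $\Psi\subset\mathbb R$, run through the $\psi\in\Psi$ in any order; whenever $f_\psi(x)>0$ at the current $x$, replace $x$ by some $r>x$ with $f_\psi(r)=0$ and $f_\psi(r+\mu)<0$ for all sufficiently small $\mu>0$ (any such $r$ is allowed). Return the final $x$. **Algorithm 1 (svsAbscissa)**, with $f_\psi(x)=g(x+\mathrm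 i\psi)-\varepsilon^{-1}$. Choose $\lambda_0\in\Lambda$ of maximal real part and let $\eta_0$ be the result of fastSearch from $\operatorname{Re}\lambda_0$ with $\Psi=\{\operatorname{Im}\lambda_0\}$. While $\eta_k<\alpha_\varepsilon$: let $\Psi$ be the set of midpoints of all intervals $[a,b]$, $a<b$, between consecutive elements of $\{y\in\mathbb R:\mathrm iy\in\sigma(\mathcal M_{\eta_k},\mathcal N)\}$ with $\eta_k+\mathrm i[a,b]\subseteq\sigma_\varepsilon$, and let $\eta_{k+1}$ be the result of fastSearch from $\eta_k$ with $\Psi$. **Algorithm 2 (svsRadius)**, with $f_\psi(r)=g(re^{\mathrm i\psi})-\varepsilon^{-1}$ and a given integer $q\ge1$. Choose $\lambda_0\in\Lambda$ of maximal modulus and let $\eta_0$ be the result of fastSearch from $|\lambda_0|$ with $\Psi$ consisting of $\operatorname{Arg}\lambda_0$ and $q$ random angles. While $\eta_k<\rho_\varepsilon$: let $\Psi$ be the set of midpoints of all intervals $[a,b]$, $a<b$, $a\in[0,2\pi)$, between consecutive elements of the $2\pi$-periodic set $\{\theta\in\mathbb R:e^{\mathrm i\theta}\in\sigma(\mathcal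 S_{\eta_k},\mathcal T_{\eta_k})\}$ with $\eta_ke^{\mathrm i\theta}\in\sigma_\varepsilon$ for all $\theta\in[a,b]$; if there are no such intervals (in particular if the pencil is singular), let $\Psi$ consist of $q$ newly drawn random angles instead; let $\eta_{k+1}$ be the result of fastSearch from $\eta_k$ with $\Psi$. All random angles are independent and uniformly distributed on $[0,2\pi)$. If a loop ends at step $k$, put $\eta_j=\eta_k$ for $j\ge k$. **Theorem.** The maxima $\alpha_\varepsilon$ and $\rho_\varepsilon$ exist. 1. Suppose that for every $\mu\in\sigma(A,E)\setminus\Lambda$ that is an isolated point of $\sigma_\varepsilon$ there is a $w\in\sigma_\varepsilon$ with $\operatorname{Re}w\ge\operatorname{Re}\mu$ that lies in $\Lambda$ or is not isolated in $\sigma_\varepsilon$ (no condition if $\Lambda=\sigma(A,E)$). Then Algorithm 1 can always be started, every step of it can be carried out, and every sequence $(\eta_k)$ it can produce converges to $\alpha_\varepsilon$. 2. Suppose that the same holds with $|w|\ge|\mu|$ in place of $\operatorname{Re}w\ge\operatorname{Re}\mu$. Then, whatever the angles drawn, Algorithm 2 can be started and every step of it can be carried out; and with probability one, every sequence $(\eta_k)$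 it can produce with the angles drawn converges to $\rho_\varepsilon$. -/

import Mathlib

open MeasureTheory ProbabilityTheory Filter Topology
open scoped Matrix Matrix.Norms.L2Operator

noncomputable section

/-- The eigenvalues of the matrix pencil `(M, N)`, i.e. the zeros of `det (z N - M)`. -/
def pencilSpec {ι : Type*} [Fintype ι] [DecidableEq ι] (M N : Matrix ι ι ℂ) : Set ℂ :=
  {z | (z • N - M).det = 0}

/-- The matrices `A, B, C, D, E` of a linear system with input and output. -/
structure LTISystem (n m p : ℕ) where
  A : Matrix (Fin n) (Fin n) ℂ
  B : Matrix (Fin n) (Fin m) ℂ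
  C : Matrix (Fin p) (Fin n) ℂ
  D : Matrix (Fin p) (Fin m) ℂ
  E : Matrix (Fin n) (Fin n) ℂ

/-- `z` is an isolated point of `S`. -/
def IsIsolatedPoint (S : Set ℂ) (z : ℂ) : Prop :=
  ∃ U ∈ 𝓝 z, S ∩ U = {z}

/-- `r` is an admissible answer of the root-finding routine for `f` started at `x₀`. -/
def IsRootToTheRight (f : ℝ → EReal) (x₀ r : ℝ) : Prop :=
  x₀ < r ∧ f r = 0 ∧ ∃ β > 0, ∀ μ ∈ Set.Ioo 0 β, f (r + μ) < 0

/-- `FastSearch f x l x'`: processing the search positions in the list `l` in the given order,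
starting from the estimate `x`, may end with the estimate `x'`. Here `f ψ` is the function whose
roots are sought at position `ψ`. -/
inductive FastSearch (f : ℝ → ℝ → EReal) : ℝ → List ℝ → ℝ → Prop
  | done (x : ℝ) : FastSearch f x [] x
  | skip {x x' ψ : ℝ} {l : List ℝ} :
      ¬ 0 < f ψ x → FastSearch f x l x' → FastSearch f x (ψ :: l) x'
  | root {x r x' ψ : ℝ} {l : List ℝ} :
      0 < f ψ x → IsRootToTheRight (f ψ) x r → FastSearch f r l x' →
        FastSearch f x (ψ :: l) x'

/-- `FastSearch` over a finite set of positions, processed in an arbitrary order. -/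
def FastSearchSet (f : ℝ → ℝ → EReal) (x : ℝ) (Ψ : Set ℝ) (x' : ℝ) : Prop :=
  ∃ l : List ℝ, l.Nodup ∧ (∀ ψ, ψ ∈ l ↔ ψ ∈ Ψ) ∧ FastSearch f x l x'

/-- `[a, b]` is an interval between two consecutive elements of `Y` all of whose points
satisfy `P`. -/
def IsCrossSection (Y : Set ℝ) (P : ℝ → Prop) (a b : ℝ) : Prop :=
  a ∈ Y ∧ b ∈ Y ∧ a < b ∧ (∀ y ∈ Set.Ioo a b, y ∉ Y) ∧ ∀ y ∈ Set.Icc a b, P y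

/-- The point with polar coordinates `(r, θ)`. -/
def polarPt (r θ : ℝ) : ℂ := (r : ℂ) * Complex.exp (θ * Complex.I)

namespace LTISystem

variable {n m p : ℕ} (S : LTISystem n m p)

/-- The perturbed system matrix `A + B Δ (I - D Δ)⁻¹ C`. -/
def pert (Δ : Matrix (Fin m) (Fin p) ℂ) : Matrix (Fin n) (Fin n) ℂ :=
  S.A + S.B * Δ * (1 - S.D * Δ)⁻¹ * S.C

/-- The spectrum of the pencil `(A, E)`. -/
def eig : Set ℂ := pencilSpec S.A S.E

/-- The `ε`-spectral value set; `‖Δ‖` is the spectral norm. -/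
def svs (ε : ℝ) : Set ℂ :=
  {z | ∃ Δ : Matrix (Fin m) (Fin p) ℂ, ‖Δ‖ ≤ ε ∧ z ∈ pencilSpec (S.pert Δ) S.E}

/-- The `ε`-spectral value set abscissa. -/
def abscissa (ε : ℝ) : ℝ := sSup (Complex.re '' S.svs ε)

/-- The `ε`-spectral value set radius. -/
def radius (ε : ℝ) : ℝ := sSup ((fun z : ℂ => ‖z‖) '' S.svs ε)

/-- Observability of `z` as an eigenvalue of `(A, E)`. -/
def IsObservable (z : ℂ) : Prop :=
  ∀ x : Fin n → ℂ, x ≠ 0 → S.A *ᵥ x = z • (S.E *ᵥ x) → S.C *ᵥ x ≠ 0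

/-- Controllability of `z` as an eigenvalue of `(A, E)`. -/
def IsControllable (z : ℂ) : Prop :=
  ∀ y : Fin n → ℂ, y ≠ 0 → star y ᵥ* S.A = z • (star y ᵥ* S.E) → S.Bᴴ *ᵥ y ≠ 0

/-- The transfer function `C (z E - A)⁻¹ B + D`, meaningful for `z ∉ S.eig`. -/
def transfer (z : ℂ) : Matrix (Fin p) (Fin m) ℂ :=
  S.C * (z • S.E - S.A)⁻¹ * S.B + S.D

open Classical in
/-- The spectral norm of the transfer function, extended to the eigenvalues of `(A, E)` by its
limit there: `⊤` at a pole, a finite value where the singularity is removable. -/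
def ntf (z : ℂ) : EReal :=
  if z ∈ S.eig then limsup (fun w : ℂ => ((‖S.transfer w‖ : ℝ) : EReal)) (𝓝[≠] z)
  else ((‖S.transfer z‖ : ℝ) : EReal)

/-- The user's selection `Λ` of eigenvalues of `(A, E)`: only uncontrollable or unobservable
eigenvalues that are not poles of the transfer function may be left out. -/
def IsSelection (Λ : Set ℂ) : Prop :=
  Λ ⊆ S.eig ∧
    ∀ z ∈ S.eig, z ∉ Λ → (¬ S.IsControllable z ∨ ¬ S.IsObservable z) ∧ S.ntf z ≠ ⊤

/-- `R = D* D - γ² I`. -/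
def R (γ : ℝ) : Matrix (Fin m) (Fin m) ℂ := S.Dᴴ * S.D - ((γ ^ 2 : ℝ) : ℂ) • 1

/-- `S = D D* - γ² I`. -/
def Sm (γ : ℝ) : Matrix (Fin p) (Fin p) ℂ := S.D * S.Dᴴ - ((γ ^ 2 : ℝ) : ℂ) • 1

/-- The matrix `𝓜` of the pencil of the vertical search. -/
def contM (γ x : ℝ) : Matrix (Fin n ⊕ Fin n) (Fin n ⊕ Fin n) ℂ :=
  Matrix.fromBlocks
    (S.A - (x : ℂ) • S.E - S.B * (S.R γ)⁻¹ * S.Dᴴ * S.C)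
    (-((γ : ℂ) • (S.B * (S.R γ)⁻¹ * S.Bᴴ)))
    ((γ : ℂ) • (S.Cᴴ * (S.Sm γ)⁻¹ * S.C))
    (-(S.A - (x : ℂ) • S.E - S.B * (S.R γ)⁻¹ * S.Dᴴ * S.C)ᴴ)

/-- The matrix `𝓝` of the pencil of the vertical search. -/
def contN : Matrix (Fin n ⊕ Fin n) (Fin n ⊕ Fin n) ℂ :=
  Matrix.fromBlocks S.E 0 0 S.Eᴴ

/-- The matrix `𝓢` of the pencil of the circular search. -/
def discS (γ r : ℝ) : Matrix (Fin n ⊕ Fin n) (Fin n ⊕ Fin n) ℂ :=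
  Matrix.fromBlocks
    (S.A - S.B * (S.R γ)⁻¹ * S.Dᴴ * S.C)
    (-((γ : ℂ) • (S.B * (S.R γ)⁻¹ * S.Bᴴ)))
    0
    ((r : ℂ) • S.Eᴴ)

/-- The matrix `𝓣` of the pencil of the circular search. -/
def discT (γ r : ℝ) : Matrix (Fin n ⊕ Fin n) (Fin n ⊕ Fin n) ℂ :=
  Matrix.fromBlocks
    ((r : ℂ) • S.E)
    0
    (-((γ : ℂ) • (S.Cᴴ * (S.Sm γ)⁻¹ * S.C)))
    (S.Aᴴ - S.Cᴴ * S.D * (S.R γ)⁻¹ * S.Bᴴ)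

/-! ### The abscissa algorithm -/

/-- The function whose roots are sought on the horizontal line `Im z = y`. -/
def horizFun (ε y x : ℝ) : EReal := S.ntf (x + y * Complex.I) - ((ε⁻¹ : ℝ) : EReal)

/-- The `y` such that `i y` is an eigenvalue of the vertical-search pencil at `x`. -/
def vertEigs (ε x : ℝ) : Set ℝ :=
  {y | (y : ℂ) * Complex.I ∈ pencilSpec (S.contM ε⁻¹ x) S.contN}

/-- The midpoints of the cross sections found by the vertical search at `x`. -/
def vertMidpoints (ε x : ℝ) : Set ℝ :=
  {ψ | ∃ a b, IsCrossSection (S.vertEigs ε x)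
    (fun y => (x + y * Complex.I : ℂ) ∈ S.svs ε) a b ∧ ψ = (a + b) / 2}

/-- `x` is a possible estimate of the abscissa algorithm on entering its loop. -/
def AbsInit (ε : ℝ) (Λ : Set ℂ) (x : ℝ) : Prop :=
  ∃ z₀ ∈ Λ, (∀ z ∈ Λ, z.re ≤ z₀.re) ∧ FastSearchSet (S.horizFun ε) z₀.re {z₀.im} x

/-- One pass of the loop of the abscissa algorithm (once the loop condition fails, the estimate
is kept). -/
def AbsStep (ε x x' : ℝ) : Prop :=
  (x < S.abscissa ε → FastSearchSet (S.horizFun ε) x (S.vertMidpoints ε x) x') ∧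
    (¬ x < S.abscissa ε → x' = x)

/-- The estimates `η 0, η 1, …` are produced by an execution of the abscissa algorithm. -/
def IsAbsRun (ε : ℝ) (Λ : Set ℂ) (η : ℕ → ℝ) : Prop :=
  S.AbsInit ε Λ (η 0) ∧ ∀ k, S.AbsStep ε (η k) (η (k + 1))

/-! ### The radius algorithm -/

/-- The function whose roots are sought on the ray with angle `θ`. -/
def radFun (ε θ r : ℝ) : EReal := S.ntf (polarPt r θ) - ((ε⁻¹ : ℝ) : EReal)

/-- The angles `θ` (all real representatives) such that `exp (i θ)` is an eigenvalue of the
circular-search pencil at radius `r`. -/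
def circEigs (ε r : ℝ) : Set ℝ :=
  {θ | Complex.exp (θ * Complex.I) ∈ pencilSpec (S.discS ε⁻¹ r) (S.discT ε⁻¹ r)}

/-- The midpoints of the arcs found by the circular search at radius `r`. As `circEigs` is
`2π`-periodic, the wrap-around arc is included. If the pencil is singular, `circEigs` is all of
`ℝ` and no arc is found. -/
def circMidpoints (ε r : ℝ) : Set ℝ :=
  {ψ | ∃ a ∈ Set.Ico 0 (2 * Real.pi), ∃ b, IsCrossSection (S.circEigs ε r)
    (fun θ => polarPt r θ ∈ S.svs ε) a b ∧ ψ = (a + b) / 2}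

open Classical in
/-- The search directions used at radius `r`: the midpoints of the arcs if there are any, and
otherwise the randomly drawn angles `φ`. -/
def radDirections (ε : ℝ) {q : ℕ} (φ : Fin q → ℝ) (r : ℝ) : Set ℝ :=
  if S.circMidpoints ε r = ∅ then Set.range φ else S.circMidpoints ε r

/-- `x` is a possible estimate of the radius algorithm on entering its loop, if the random angles
drawn before are `φ`. -/
def RadInit (ε : ℝ) (Λ : Set ℂ) {q : ℕ} (φ : Fin q → ℝ) (x : ℝ) : Prop :=
  ∃ z₀ ∈ Λ, (∀ z ∈ Λ, ‖z‖ ≤ ‖z₀‖) ∧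
    FastSearchSet (S.radFun ε) ‖z₀‖ (insert z₀.arg (Set.range φ)) x

/-- One pass of the loop of the radius algorithm, with random angles `φ`. -/
def RadStep (ε : ℝ) {q : ℕ} (φ : Fin q → ℝ) (x x' : ℝ) : Prop :=
  (x < S.radius ε → FastSearchSet (S.radFun ε) x (S.radDirections ε φ x) x') ∧
    (¬ x < S.radius ε → x' = x)

/-- The estimates `η 0, η 1, …` are produced by an execution of the radius algorithm in which the
angles drawn are `φ 0` initially and `φ (k + 1)` in the `k`-th pass of the loop. -/
def IsRadRun (ε : ℝ) (Λ : Set ℂ) {q : ℕ} (φ : ℕ → Fin q → ℝ) (η : ℕ → ℝ) : Prop :=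
  S.RadInit ε Λ (φ 0) (η 0) ∧ ∀ k, S.RadStep ε (φ (k + 1)) (η k) (η (k + 1))

end LTISystem

end

/-!
Away from the eigenvalues, the spectral value set is `{g ≥ ε⁻¹}`, where `g` is the norm of the
transfer function. By the maximum principle no point with `g = ε⁻¹` is a local maximum of `g`, and
every component of the open set `{g > ε⁻¹}` contains a pole. Since `Λ` contains the poles, estimates
that stall below the maximum stall at a line (or circle) which meets `{g > ε⁻¹}`.

Near such a point the cross sections at the estimates have positive length: either they contain
points far from it and do not shrink, or they lie in a box on which `g > ε⁻¹`. In both cases a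
search from a midpoint eventually moves past the stall. For long cross sections the reason is that
the level curves of `g` are algebraic: a midpoint can be blocked only if, just before the blocking
contact, `g` has local minima along the search curves at levels slightly above `ε⁻¹`, but the
levels at such minima are zeros of a nonzero polynomial and therefore stay away from `ε⁻¹` when
approached in this way.

On circles there may be no cross section at all. If this happens at all but finitely many steps,
the independent random angles almost surely visit every open set of directions infinitely often,
and one of these visits moves the estimate past the stall.
-/

section Search

variable {f : ℝ → ℝ → EReal} {x x' L : ℝ} {Ψ : Set ℝ}

namespace FastSearch

variable {l : List ℝ}

theorem le (h : FastSearch f x l x') : x ≤ x' := by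
  induction h with
  | done => exact le_rfl
  | skip _ _ ih => exact ih
  | root _ hr _ ih => exact hr.1.le.trans ih

theorem le_of_forall_root_le (h : FastSearch f x l x') (hroot : ∀ ψ r, f ψ r = 0 → r ≤ L)
    (hx : x ≤ L) : x' ≤ L := by
  induction h with
  | done => exact hx
  | skip _ _ ih => exact ih hx
  | root _ hr _ ih => exact ih (hroot _ _ hr.2.1)

theorem exists_not_pos (h : FastSearch f x l x') {ψ : ℝ} (hψ : ψ ∈ l) :
    ∃ t ∈ Set.Icc x x', ¬ 0 < f ψ t := by
  induction h with
  | done => simp at hψ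
  | @skip x x' φ l hφ h ih =>
    rcases List.mem_cons.1 hψ with rfl | hψ
    · exact ⟨x, ⟨le_rfl, h.le⟩, hφ⟩
    · exact ih hψ
  | @root x r x' φ l _ hr h ih =>
    rcases List.mem_cons.1 hψ with rfl | hψ
    · exact ⟨r, ⟨hr.1.le, h.le⟩, hr.2.1.not_gt⟩
    · obtain ⟨t, ht, hft⟩ := ih hψ
      exact ⟨t, ⟨hr.1.le.trans ht.1, ht.2⟩, hft⟩

end FastSearch

theorem exists_fastSearch (hroot : ∀ ψ x, 0 < f ψ x → ∃ r, IsRootToTheRight (f ψ) x r)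
    (x : ℝ) (l : List ℝ) : ∃ x', FastSearch f x l x' := by
  induction l generalizing x with
  | nil => exact ⟨x, .done x⟩
  | cons ψ l ih =>
    by_cases hpos : 0 < f ψ x
    · obtain ⟨r, hr⟩ := hroot ψ x hpos
      exact (ih r).imp fun _ => .root hpos hr
    · exact (ih x).imp fun _ => .skip hpos

namespace FastSearchSet

theorem le (h : FastSearchSet f x Ψ x') : x ≤ x' :=
  h.elim fun _ hl => hl.2.2.le

theorem le_of_forall_root_le (h : FastSearchSet f x Ψ x') (hroot : ∀ ψ r, f ψ r = 0 → r ≤ L)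
    (hx : x ≤ L) : x' ≤ L :=
  h.elim fun _ hl => hl.2.2.le_of_forall_root_le hroot hx

theorem exists_not_pos (h : FastSearchSet f x Ψ x') {ψ : ℝ} (hψ : ψ ∈ Ψ) :
    ∃ t ∈ Set.Icc x x', ¬ 0 < f ψ t :=
  h.elim fun _ hl => hl.2.2.exists_not_pos ((hl.2.1 ψ).2 hψ)

end FastSearchSet

theorem exists_fastSearchSet (hroot : ∀ ψ x, 0 < f ψ x → ∃ r, IsRootToTheRight (f ψ) x r)
    (hΨ : Ψ.Finite) (x : ℝ) : ∃ x', FastSearchSet f x Ψ x' := by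
  obtain ⟨x', hx'⟩ := exists_fastSearch hroot x hΨ.toFinset.toList
  exact ⟨x', _, Finset.nodup_toList _, by simp, hx'⟩

/-- One pass of a search loop with target value `L` and search positions `Ψ`: the common shape of
`LTISystem.AbsStep` and `LTISystem.RadStep`. -/
def SearchStep (f : ℝ → ℝ → EReal) (L : ℝ) (Ψ : Set ℝ) (x x' : ℝ) : Prop :=
  (x < L → FastSearchSet f x Ψ x') ∧ (¬ x < L → x' = x)

theorem exists_searchStep (hroot : ∀ ψ x, 0 < f ψ x → ∃ r, IsRootToTheRight (f ψ) x r)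
    (hΨ : Ψ.Finite) (L x : ℝ) : ∃ x', SearchStep f L Ψ x x' := by
  by_cases hx : x < L
  · obtain ⟨x', hx'⟩ := exists_fastSearchSet hroot hΨ x
    exact ⟨x', fun _ => hx', fun h => absurd hx h⟩
  · exact ⟨x, fun h => absurd h hx, fun _ => rfl⟩

namespace SearchStep

theorem le (h : SearchStep f L Ψ x x') : x ≤ x' := by
  by_cases hx : x < L
  · exact (h.1 hx).le
  · exact (h.2 hx).ge

theorem le_of_forall_root_le (h : SearchStep f L Ψ x x') (hroot : ∀ ψ r, f ψ r = 0 → r ≤ L)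
    (hx : x ≤ L) : x' ≤ L := by
  by_cases hlt : x < L
  · exact (h.1 hlt).le_of_forall_root_le hroot hx
  · exact (h.2 hlt).trans_le hx

variable {η : ℕ → ℝ} {Θ : ℕ → Set ℝ}

theorem monotone (h : ∀ k, SearchStep f L (Θ k) (η k) (η (k + 1))) : Monotone η :=
  monotone_nat_of_le_succ fun k => (h k).le

theorem tendsto (h : ∀ k, SearchStep f L (Θ k) (η k) (η (k + 1)))
    (hroot : ∀ ψ r, f ψ r = 0 → r ≤ L) (h₀ : η 0 ≤ L)
    (hlim : ∀ η', Tendsto η atTop (𝓝 η') → L ≤ η') : Tendsto η atTop (𝓝 L) := by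
  have hle : ∀ k, η k ≤ L := fun k => by
    induction k with
    | zero => exact h₀
    | succ k ih => exact (h k).le_of_forall_root_le hroot ih
  have hsup := tendsto_atTop_ciSup (monotone h) ⟨L, Set.forall_mem_range.2 hle⟩
  rwa [(ciSup_le hle).antisymm (hlim _ hsup)] at hsup

end SearchStep

end Search

section Level

variable {u : ℝ → EReal}

theorem ereal_sub_coe_eq_zero_iff {a : EReal} {c : ℝ} : a - (c : EReal) = 0 ↔ a = c := by
  induction a with
  | bot => simp
  | top => simp
  | coe a => norm_cast; exact sub_eq_zero

theorem exists_isRootToTheRight (hu : Continuous u) {c x₀ M : ℝ} (h₀ : c < u x₀)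
    (hM : ∀ x ≥ M, u x < c) : ∃ r, IsRootToTheRight (fun x => u x - (c : EReal)) x₀ r := by
  obtain ⟨r, ⟨hxr, hcr⟩, hmax⟩ : ∃ r, IsGreatest {x | x₀ ≤ x ∧ (c : EReal) ≤ u x} r :=
    ⟨_, (isClosed_Ici.inter (isClosed_Ici.preimage hu)).isGreatest_csSup
      ⟨x₀, Set.self_mem_Ici, h₀.le⟩ ⟨M, fun x hx => not_lt.1 fun h => (hM x h.le).not_ge hx.2⟩⟩
  have hafter : ∀ x > r, u x < c := fun x hx =>
    not_le.1 fun h => hx.not_ge (hmax ⟨hxr.trans hx.le, h⟩)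
  have hr : u r = c := by
    refine (le_of_tendsto (hu.continuousWithinAt (s := Set.Ioi r)).tendsto ?_).antisymm hcr
    filter_upwards [self_mem_nhdsWithin] with x hx using (hafter x hx).le
  have hlt : x₀ < r := hxr.lt_of_ne fun h => by simp [h, hr] at h₀
  exact ⟨r, hlt, ereal_sub_coe_eq_zero_iff.2 hr, 1, one_pos, fun μ hμ =>
    (EReal.sub_neg (by simp) (by simp)).2 (hafter _ (lt_add_of_pos_right r hμ.1))⟩

theorem lt_on_of_ne {X : Type*} [TopologicalSpace X] {v : X → EReal} {s : Set X}
    (hs : IsPreconnected s) (hv : ContinuousOn v s) {c : EReal} (hne : ∀ y ∈ s, v y ≠ c)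
    {y₀ : X} (hy₀ : y₀ ∈ s) (h₀ : c < v y₀) : ∀ y ∈ s, c < v y := by
  intro y hy
  by_contra! hle
  obtain ⟨z, hz, hvz⟩ := hs.intermediate_value hy hy₀ hv ⟨hle, h₀.le⟩
  exact hne z hz hvz

end Level

section CrossSection

variable {Y : Set ℝ}

theorem exists_consecutive (hY : IsClosed Y) {y a b : ℝ} (hy : y ∉ Y) (ha : a ∈ Y) (hb : b ∈ Y)
    (hay : a ≤ y) (hyb : y ≤ b) :
    ∃ c ∈ Y ∩ Set.Icc a b, ∃ d ∈ Y ∩ Set.Icc a b, y ∈ Set.Ioo c d ∧ ∀ z ∈ Set.Ioo c d, z ∉ Y := by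
  obtain ⟨c, ⟨hcY, hcy⟩, hc⟩ : ∃ c, IsGreatest (Y ∩ Set.Iic y) c :=
    ⟨_, (hY.inter isClosed_Iic).isGreatest_csSup ⟨a, ha, hay⟩ ⟨y, fun _ h => h.2⟩⟩
  obtain ⟨d, ⟨hdY, hyd⟩, hd⟩ : ∃ d, IsLeast (Y ∩ Set.Ici y) d :=
    ⟨_, (hY.inter isClosed_Ici).isLeast_csInf ⟨b, hb, hyb⟩ ⟨y, fun _ h => h.2⟩⟩
  have hac := hc ⟨ha, hay⟩
  have hdb := hd ⟨hb, hyb⟩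
  refine ⟨c, ⟨hcY, hac, hcy.trans hyb⟩, d, ⟨hdY, hay.trans hyd, hdb⟩,
    ⟨hcy.lt_of_ne fun h => hy (h ▸ hcY), hyd.lt_of_ne' fun h => hy (h ▸ hdY)⟩, fun z hz hzY => ?_⟩
  rcases le_total z y with h | h
  · exact (hc ⟨hzY, h⟩).not_gt hz.1
  · exact (hd ⟨hzY, h⟩).not_gt hz.2

theorem IsCrossSection.mono {P Q : ℝ → Prop} {a b : ℝ} (h : IsCrossSection Y P a b)
    (hPQ : ∀ y, P y → Q y) : IsCrossSection Y Q a b :=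
  ⟨h.1, h.2.1, h.2.2.1, h.2.2.2.1, fun y hy => hPQ y (h.2.2.2.2 y hy)⟩

theorem IsCrossSection.midpoint_notMem {P : ℝ → Prop} {a b : ℝ} (h : IsCrossSection Y P a b) :
    (a + b) / 2 ∉ Y :=
  h.2.2.2.1 _ ⟨by linarith [h.2.2.1], by linarith [h.2.2.1]⟩

theorem IsCrossSection.right_unique {P : ℝ → Prop} {a b b' : ℝ} (h : IsCrossSection Y P a b)
    (h' : IsCrossSection Y P a b') : b = b' :=
  le_antisymm (not_lt.1 fun hlt => h.2.2.2.1 b' ⟨h'.2.2.1, hlt⟩ h'.2.1)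
    (not_lt.1 fun hlt => h'.2.2.2.1 b ⟨h.2.2.1, hlt⟩ h.2.1)

theorem IsCrossSection.add_const {P : ℝ → Prop} {a b c : ℝ}
    (h : IsCrossSection Y P a b) (hY : Function.Periodic (· ∈ Y) c) (hP : Function.Periodic P c) :
    IsCrossSection Y P (a + c) (b + c) := by
  refine ⟨(hY a).mpr h.1, (hY b).mpr h.2.1, by linarith [h.2.2.1], fun y hy hyY => ?_,
    fun y hy => ?_⟩
  · exact h.2.2.2.1 (y - c) ⟨by linarith [hy.1], by linarith [hy.2]⟩ ((hY.sub_eq y).mpr hyY)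
  · rw [← hP.sub_eq]
    exact h.2.2.2.2 (y - c) ⟨by linarith [hy.1], by linarith [hy.2]⟩

theorem finite_setOf_crossSection_midpoint {s : Set ℝ} (hs : (Y ∩ s).Finite) (P : ℝ → Prop) :
    {ψ | ∃ a ∈ s, ∃ b, IsCrossSection Y P a b ∧ ψ = (a + b) / 2}.Finite := by
  have hsub : ∀ a, {ψ | ∃ b, IsCrossSection Y P a b ∧ ψ = (a + b) / 2}.Subsingleton := by
    rintro a _ ⟨b, hb, rfl⟩ _ ⟨b', hb', rfl⟩
    rw [hb.right_unique hb']
  refine (hs.biUnion fun a _ => (hsub a).finite).subset ?_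
  rintro ψ ⟨a, ha, b, hab, rfl⟩
  exact Set.mem_biUnion ⟨hab.1, ha⟩ ⟨b, hab, rfl⟩

theorem exists_isCrossSection_near {u : ℝ → EReal} (hu : Continuous u) {γ : EReal}
    (hY : IsClosed Y) (hdense : Dense Yᶜ) (hlevel : ∀ y, u y = γ → y ∈ Y) {y₀ δ a b : ℝ}
    (hδ : 0 < δ) (hbox : ∀ y ∈ Set.Icc (y₀ - δ) (y₀ + δ), γ < u y) (ha : a ∈ Y) (hb : b ∈ Y)
    (hay : a ≤ y₀ - δ) (hyb : y₀ + δ ≤ b) :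
    ∃ c ∈ Set.Icc a b, ∃ d ∈ Set.Icc a b, IsCrossSection Y (fun y => γ ≤ u y) c d ∧
      (∀ y ∈ Set.Ioo c d, γ < u y) ∧
        (δ / 2 ≤ d - c ∨ Set.Icc c d ⊆ Set.Icc (y₀ - δ) (y₀ + δ)) := by
  obtain ⟨y, hyY, hy₁, hy₂⟩ := hdense.exists_between (show y₀ - δ / 2 < y₀ + δ / 2 by linarith)
  obtain ⟨c, ⟨hcY, hc⟩, d, ⟨hdY, hd⟩, hycd, hempty⟩ :=
    exists_consecutive hY hyY ha hb (by linarith) (by linarith)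
  have hgt : ∀ z ∈ Set.Ioo c d, γ < u z :=
    lt_on_of_ne isPreconnected_Ioo hu.continuousOn (fun z hz h => hempty z hz (hlevel z h)) hycd
      (hbox y ⟨by linarith, by linarith⟩)
  have hge : ∀ z ∈ Set.Icc c d, γ ≤ u z := by
    rw [← closure_Ioo (hycd.1.trans hycd.2).ne]
    exact closure_minimal (fun z hz => (hgt z hz).le) (isClosed_Ici.preimage hu)
  refine ⟨c, hc, d, hd, ⟨hcY, hdY, hycd.1.trans hycd.2, hempty, hge⟩, hgt, ?_⟩
  by_cases hc' : y₀ - δ ≤ c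
  · by_cases hd' : d ≤ y₀ + δ
    · exact .inr (Set.Icc_subset_Icc hc' hd')
    · exact .inl (by linarith [hycd.1])
  · exact .inl (by linarith [hycd.2])

end CrossSection

section Polynomial

open Polynomial

theorem exists_map_eq_C_mul {R K : Type*} [CommRing R] [IsDomain R] [Field K]
    [Algebra R K] [IsFractionRing R K] (f : K[X]) :
    ∃ c : R, c ≠ 0 ∧ ∃ g : R[X], g.map (algebraMap R K) = C (algebraMap R K c) * f := by
  obtain ⟨c, hc, hg⟩ := IsLocalization.integerNormalization_spec (nonZeroDivisors R) f
  refine ⟨c, nonZeroDivisors.ne_zero hc, _, hg.trans ?_⟩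
  rw [← smul_eq_C_mul, algebraMap_smul]

/-- `Q` is the radical of `P` over the field of fractions, with the denominators cleared. -/
theorem exists_squarefree_part {R : Type*} [CommRing R] [IsDomain R] [CharZero R] {P : R[X]}
    (hP : P ≠ 0) : ∃ (Q A B G : R[X]) (N : ℕ) (e : R), e ≠ 0 ∧
      A * Q + B * derivative Q = C e ∧ C e * Q ^ N = G * P := by
  let K := FractionRing R
  have hRK : Function.Injective (algebraMap R K) := IsFractionRing.injective R K
  have hinj := map_injective (algebraMap R K) hRK
  have : CharZero K := charZero_of_injective_algebraMap hRK
  have hPK : P.map (algebraMap R K) ≠ 0 := (Polynomial.map_ne_zero_iff hRK).2 hP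
  obtain ⟨r, ⟨a, b, hab⟩, N, k, hk⟩ :
      ∃ r : K[X], r.Separable ∧ ∃ N, P.map (algebraMap R K) ∣ r ^ N := by
    classical
    exact ⟨UniqueFactorizationMonoid.radical (P.map (algebraMap R K)),
      PerfectField.separable_iff_squarefree.2 UniqueFactorizationMonoid.squarefree_radical,
      UniqueFactorizationMonoid.exists_dvd_radical_self_pow hPK⟩
  obtain ⟨c, hc, Q, hQ⟩ := exists_map_eq_C_mul (R := R) r
  obtain ⟨α, hα, A, hA⟩ := exists_map_eq_C_mul (R := R) a
  obtain ⟨β, hβ, B, hB⟩ := exists_map_eq_C_mul (R := R) b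
  obtain ⟨κ, hκ, G, hG⟩ := exists_map_eq_C_mul (R := R) k
  have hQ' : (derivative Q).map (algebraMap R K) = C (algebraMap R K c) * derivative r := by
    rw [← derivative_map, hQ, derivative_C_mul]
  refine ⟨Q, C (κ * β) * A, C (κ * α) * B, C (α * β * c * c ^ N) * G, N, α * β * c * κ,
    by simp [hα, hβ, hc, hκ], hinj ?_, hinj ?_⟩
  · simp only [Polynomial.map_add, Polynomial.map_mul, map_C, hA, hB, hQ, hQ', map_mul]
    linear_combination C (algebraMap R K α) * C (algebraMap R K β) * C (algebraMap R K c) *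
      C (algebraMap R K κ) * hab
  · simp only [Polynomial.map_mul, Polynomial.map_pow, map_C, hG, hQ, map_mul, map_pow, mul_pow]
    linear_combination C (algebraMap R K α) * C (algebraMap R K β) * C (algebraMap R K c) *
      C (algebraMap R K κ) * C (algebraMap R K c) ^ N * hk

theorem exists_simple_zeros {R F : Type*} [CommRing R] [IsDomain R] [CharZero R] [CommRing F]
    [IsDomain F] {P : R[X]} (hP : P ≠ 0) :
    ∃ (Q : R[X]) (e : R), e ≠ 0 ∧ ∀ (φ : R →+* F) (y : F), φ e ≠ 0 → P.eval₂ φ y = 0 →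
      Q.eval₂ φ y = 0 ∧ (derivative Q).eval₂ φ y ≠ 0 := by
  obtain ⟨Q, A, B, G, N, e, he, hsep, hdvd⟩ := exists_squarefree_part hP
  refine ⟨Q, e, he, fun φ y hφe hPy => ?_⟩
  have hsep' := congrArg (eval₂ φ y) hsep
  have hdvd' := congrArg (eval₂ φ y) hdvd
  simp only [eval₂_add, eval₂_mul, eval₂_pow, eval₂_C, hPy, mul_zero] at hsep' hdvd'
  have hQy : Q.eval₂ φ y = 0 := eq_zero_of_pow_eq_zero ((mul_eq_zero.1 hdvd').resolve_left hφe)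
  refine ⟨hQy, fun hQ'y => hφe ?_⟩
  simpa [hQy, hQ'y] using hsep'.symm

theorem continuous_evalEval (p : ℂ[X][X]) : Continuous fun z : ℂ × ℂ => p.evalEval z.1 z.2 := by
  simp only [evalEval, eval_eq_sum_range (p := p), eval_finsetSum, eval_mul, eval_pow, eval_C]
  fun_prop

theorem eventually_nhdsNE_eval_ofReal_ne_zero {d : ℂ[X]} (hd : d ≠ 0) (x₀ : ℝ) :
    ∀ᶠ x : ℝ in 𝓝[≠] x₀, d.eval (x : ℂ) ≠ 0 := by
  have hfin : {x : ℝ | d.eval (x : ℂ) = 0}.Finite :=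
    (finite_setOfPred_isRoot hd).preimage Complex.ofReal_injective.injOn
  have hmem := (hfin.subset (Set.sdiff_subset (t := {x₀}))).isClosed.isOpen_compl.mem_nhds
    (show x₀ ∉ _ by simp)
  filter_upwards [nhdsWithin_le_nhds hmem, self_mem_nhdsWithin] with x hx hne h
  exact hx ⟨h, hne⟩

/-- Divide `e` by the largest power of `s - γ ^ 2`. -/
theorem eventually_evalEval_sq_ne_zero {e : ℂ[X][X]} (he : e ≠ 0) {γ : ℝ} (hγ : 0 < γ) (η : ℝ) :
    ∀ᶠ x₀ : ℝ in 𝓝[<] η, ∀ᶠ z : ℝ × ℝ in 𝓝 (x₀, γ), γ < z.2 →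
      e.evalEval (z.1 : ℂ) ((z.2 ^ 2 : ℝ) : ℂ) ≠ 0 := by
  obtain ⟨D, hD, hDdvd⟩ :=
    exists_eq_pow_rootMultiplicity_mul_and_not_dvd e he (C ((γ ^ 2 : ℝ) : ℂ))
  rw [dvd_iff_isRoot] at hDdvd
  filter_upwards [nhdsWithin_mono η (fun x (hx : x < η) => hx.ne)
    (eventually_nhdsNE_eval_ofReal_ne_zero hDdvd η)] with x₀ hx₀
  have hcont : Continuous fun z : ℝ × ℝ => D.evalEval (z.1 : ℂ) ((z.2 ^ 2 : ℝ) : ℂ) :=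
    (continuous_evalEval D).comp
      (f := fun z : ℝ × ℝ => ((z.1 : ℂ), ((z.2 ^ 2 : ℝ) : ℂ))) (by fun_prop)
  filter_upwards [hcont.continuousAt.eventually_ne (show D.evalEval _ _ ≠ 0 from hx₀)] with z hz hγz
  rw [hD, evalEval_mul, evalEval_pow, evalEval_sub, evalEval_X, evalEval_C, eval_C,
    ← Complex.ofReal_sub]
  refine mul_ne_zero (pow_ne_zero _ (Complex.ofReal_ne_zero.2 ?_)) hz
  nlinarith

/-- Evaluation of polynomials in three nested variables, at `x` in the innermost one, at `s` in
the middle one and at `w` in the outermost one. -/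
noncomputable def evalHom₃ (x s w : ℂ) : ℂ[X][X][X] →+* ℂ :=
  eval₂RingHom (evalEvalRingHom x s) w

theorem evalHom₃_eq_eval_map (x s w : ℂ) (P : ℂ[X][X][X]) :
    evalHom₃ x s w P = (P.map (evalEvalRingHom x s)).eval w :=
  (eval_map _ _).symm

theorem continuous_evalHom₃ (P : ℂ[X][X][X]) :
    Continuous fun z : ℂ × ℂ × ℂ => evalHom₃ z.1 z.2.1 z.2.2 P := by
  simp only [evalHom₃, coe_eval₂RingHom, eval₂_eq_sum_range, coe_evalEvalRingHom]
  refine continuous_finsetSum _ fun i _ => ?_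
  exact ((continuous_evalEval (P.coeff i)).comp (f := fun z : ℂ × ℂ × ℂ => (z.1, z.2.1))
    (by fun_prop)).mul (by fun_prop)

theorem exists_evalHom₃_eq_eval (P : ℂ[X][X][X]) (s w : ℂ) :
    ∃ d : ℂ[X], ∀ x, d.eval x = evalHom₃ x s w P := by
  refine ⟨(P.eval (C (C w))).eval (C s), fun x => ?_⟩
  have h := eval₂_at_apply (p := P) (evalEvalRingHom x s) (C (C w))
  simpa [evalHom₃, evalEval] using h.symm

end Polynomial

section LocalMin

theorem not_isLocalMin_of_injOn {u : ℝ → ℝ} {V : Set ℝ} {y₀ : ℝ} (hV : V ∈ 𝓝 y₀)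
    (hu : ContinuousOn u V) (hinj : Set.InjOn u V) : ¬ IsLocalMin u y₀ := by
  intro hmin
  obtain ⟨a, ha, hsub⟩ := Metric.nhds_basis_closedBall.mem_iff.1 (Filter.inter_mem hV hmin)
  rw [Real.closedBall_eq_Icc, Set.subset_inter_iff] at hsub
  obtain ⟨hsubV, hle⟩ := hsub
  have hl : y₀ - a ∈ Set.Icc (y₀ - a) (y₀ + a) := ⟨le_rfl, by linarith⟩
  have hr : y₀ + a ∈ Set.Icc (y₀ - a) (y₀ + a) := ⟨by linarith, le_rfl⟩
  have hm : y₀ ∈ Set.Icc (y₀ - a) (y₀ + a) := ⟨by linarith, by linarith⟩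
  rcases (hu.mono hsubV).strictMonoOn_of_injOn_Icc' (by linarith) (hinj.mono hsubV) with h | h
  · exact (h hl hm (by linarith)).not_ge (hle hl)
  · exact (h hm hr (by linarith)).not_ge (hle hr)

/-- Rotate so that the derivative at the base point is a positive real number; then the real part
is strictly increasing near the base point. -/
theorem exists_injOn_of_deriv_ne_zero {T : Type*} [TopologicalSpace T] {Φ Φ' : ℝ → T → ℂ}
    (hΦ : ∀ y s, HasDerivAt (fun y => Φ y s) (Φ' y s) y) {y₀ : ℝ} {s₀ : T}
    (hΦ' : ContinuousAt (Function.uncurry Φ') (y₀, s₀)) (h₀ : Φ' y₀ s₀ ≠ 0) :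
    ∃ V ∈ 𝓝 y₀, ∃ W ∈ 𝓝 s₀, ∀ s ∈ W, Set.InjOn (fun y => Φ y s) V := by
  set c : ℂ := starRingEnd ℂ (Φ' y₀ s₀) with hc
  have hpos₀ : 0 < (c * Φ' y₀ s₀).re := by
    rw [hc, mul_comm, Complex.mul_conj]
    simpa only [Complex.ofReal_re] using Complex.normSq_pos.2 h₀
  have hpos : ∀ᶠ z : ℝ × T in 𝓝 (y₀, s₀), 0 < (c * Φ' z.1 z.2).re :=
    (Complex.continuous_re.continuousAt.comp
      (continuousAt_const.mul hΦ')).eventually (lt_mem_nhds hpos₀)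
  obtain ⟨V, hV, W, hW, hVW⟩ := mem_nhds_prod_iff.1 hpos
  obtain ⟨a, ha, haV⟩ := Metric.nhds_basis_closedBall.mem_iff.1 hV
  refine ⟨_, Metric.closedBall_mem_nhds y₀ ha, W, hW, fun s hs => ?_⟩
  have hder : ∀ y, HasDerivAt (fun y => (c * Φ y s).re) (c * Φ' y s).re y :=
    fun y => Complex.reCLM.hasFDerivAt.comp_hasDerivAt y ((hΦ y s).const_mul c)
  have hmono : StrictMonoOn (fun y => (c * Φ y s).re) (Metric.closedBall y₀ a) := by
    refine strictMonoOn_of_deriv_pos (convex_closedBall _ _)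
      (fun y _ => (hder y).continuousAt.continuousWithinAt) fun y hy => ?_
    rw [(hder y).deriv]
    exact hVW (Set.mk_mem_prod (haV (interior_subset hy)) hs)
  exact fun y₁ hy₁ y₂ hy₂ he => hmono.injOn hy₁ hy₂ (congrArg (fun z => (c * z).re) he)

theorem not_isLocalMin_of_eventually_eq_zero {Φ Φ' : ℝ → ℝ → ℂ}
    (hΦ : ∀ y s, HasDerivAt (fun y => Φ y s) (Φ' y s) y) {u : ℝ → ℝ} {y₀ : ℝ}
    (hΦ' : ContinuousAt (Function.uncurry Φ') (y₀, u y₀)) (h₀ : Φ' y₀ (u y₀) ≠ 0)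
    (hu : ∀ᶠ y in 𝓝 y₀, ContinuousAt u y) (hz : ∀ᶠ y in 𝓝 y₀, Φ y (u y) = 0) :
    ¬ IsLocalMin u y₀ := by
  obtain ⟨V, hV, W, hW, hinj⟩ := exists_injOn_of_deriv_ne_zero hΦ hΦ' h₀
  have hev : ∀ᶠ y in 𝓝 y₀, y ∈ V ∧ u y ∈ W ∧ ContinuousAt u y ∧ Φ y (u y) = 0 :=
    Filter.Eventually.and hV ((hu.self_of_nhds.eventually hW).and (hu.and hz))
  refine not_isLocalMin_of_injOn hev (fun y hy => hy.2.2.1.continuousWithinAt) ?_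
  intro y₁ hy₁ y₂ hy₂ he
  have hz₁ : Φ y₁ (u y₁) = 0 := hy₁.2.2.2
  have hz₂ : Φ y₂ (u y₁) = 0 := he ▸ hy₂.2.2.2
  exact hinj _ hy₁.2.1 hy₁.1 hy₂.1 (hz₁.trans hz₂.symm)

theorem eventually_exists_pos_eq_coe {X : Type*} [TopologicalSpace X] {v : X → EReal} {x₀ : X}
    {σ : ℝ} (hv : ContinuousAt v x₀) (hσ : 0 < σ) (hx₀ : v x₀ = σ) :
    ∀ᶠ x in 𝓝 x₀, ∃ τ : ℝ, 0 < τ ∧ v x = τ := by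
  have hmem : v x₀ ∈ Set.Ioo 0 ⊤ := by simp [hx₀, hσ]
  filter_upwards [hv.eventually (isOpen_Ioo.mem_nhds hmem)] with x hx
  lift v x to ℝ using ⟨hx.2.ne, (EReal.bot_lt_zero.trans hx.1).ne'⟩ with τ
  exact ⟨τ, by exact_mod_cast hx.1, rfl⟩

theorem eventually_nhdsLT_forall_Ico {a : ℝ} {p : ℝ → Prop} (hp : ∀ᶠ x in 𝓝[<] a, p x) :
    ∀ᶠ x in 𝓝[<] a, ∀ y ∈ Set.Ico x a, p y := by
  obtain ⟨l, hl, hsub⟩ := mem_nhdsLT_iff_exists_Ioo_subset.1 hp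
  filter_upwards [Ioo_mem_nhdsLT hl] with x hx y hy
  exact hsub ⟨hx.1.trans_le hy.1, hy.2⟩

theorem dense_compl_preimage_of_deriv_ne_zero {w w' : ℝ → ℂ} (hw : ∀ y, HasDerivAt w (w' y) y)
    (hw' : ∀ y, w' y ≠ 0) {F : Set ℂ} (hF : F.Finite) : Dense (w ⁻¹' F)ᶜ := by
  intro y
  have hev : ∀ᶠ z in 𝓝[≠] y, ∀ c ∈ F, w z ≠ c :=
    (Filter.eventually_all_finite hF).2 fun c _ => (hw y).eventually_ne (hw' y)
  exact mem_closure_iff_frequently.2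
    ((hev.mono fun z hz hzF => hz _ hzF rfl).frequently.filter_mono nhdsWithin_le_nhds)

variable {h : ℝ → ℝ → EReal} {x₁ y₁ y₂ : ℝ}

theorem exists_first_contact (hh : Continuous (Function.uncurry h)) {γ : EReal} {t : ℝ}
    (hx₁t : x₁ ≤ t) (hleft : ∀ y ∈ Set.Icc y₁ y₂, γ < h x₁ y)
    (ht : ∃ y ∈ Set.Icc y₁ y₂, h t y ≤ γ) :
    ∃ x₀ ∈ Set.Ioc x₁ t, (∃ y ∈ Set.Icc y₁ y₂, h x₀ y ≤ γ) ∧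
      ∀ x ∈ Set.Ico x₁ x₀, ∀ y ∈ Set.Icc y₁ y₂, γ < h x y := by
  obtain ⟨y, hy, hty⟩ := ht
  have hcpt : IsCompact (Prod.fst '' ((Set.Icc x₁ t ×ˢ Set.Icc y₁ y₂) ∩
      {z : ℝ × ℝ | h z.1 z.2 ≤ γ})) :=
    ((isCompact_Icc.prod isCompact_Icc).inter_right (isClosed_Iic.preimage hh)).image continuous_fst
  obtain ⟨_, ⟨⟨x₀, y₀⟩, ⟨⟨hx₀, hy₀⟩, hle⟩, rfl⟩, hmin⟩ :=
    hcpt.exists_isLeast ⟨t, (t, y), ⟨⟨⟨hx₁t, le_rfl⟩, hy⟩, hty⟩, rfl⟩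
  refine ⟨x₀, ⟨hx₀.1.lt_of_ne ?_, hx₀.2⟩, ⟨y₀, hy₀, hle⟩, fun x hx z hz => ?_⟩
  · rintro rfl
    exact (hleft y₀ hy₀).not_ge hle
  · by_contra! hxz
    exact hx.2.not_ge (hmin ⟨(x, z), ⟨⟨⟨hx.1, hx.2.le.trans hx₀.2⟩, hz⟩, hxz⟩, rfl⟩)

/-- Just before the first contact, the minimum of `h x` over the interval lies slightly above `γ`
and, the values at the end points being larger, is attained in the interior. -/
theorem frequently_isLocalMin_of_first_contact (hh : Continuous (Function.uncurry h))
    {γ x₀ : ℝ} (hx₁ : x₁ < x₀) (hleft : ∀ x ∈ Set.Ico x₁ x₀, ∀ y ∈ Set.Icc y₁ y₂, γ < h x y)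
    (hside₁ : γ < h x₀ y₁) (hside₂ : γ < h x₀ y₂) (hx₀ : ∃ y ∈ Set.Icc y₁ y₂, h x₀ y ≤ γ) :
    ∃ᶠ z : ℝ × ℝ in 𝓝 (x₀, γ), γ < z.2 ∧ ∃ y, h z.1 y = z.2 ∧ IsLocalMin (h z.1) y := by
  obtain ⟨y₀, hy₀, hle⟩ := hx₀
  set m : ℝ → EReal := fun x => sInf (h x '' Set.Icc y₁ y₂)
  have hm : Tendsto m (𝓝[<] x₀) (𝓝 (m x₀)) :=
    ((isCompact_Icc.continuous_sInf hh).tendsto x₀).mono_left nhdsWithin_le_nhds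
  have hcont : ∀ y, Tendsto (fun x => h x y) (𝓝[<] x₀) (𝓝 (h x₀ y)) := fun y =>
    ((hh.comp (.prodMk_left y)).tendsto x₀).mono_left nhdsWithin_le_nhds
  have hnear : ∀ᶠ x in 𝓝[<] x₀, x ∈ Set.Ico x₁ x₀ := Ico_mem_nhdsLT hx₁
  have hγm : m x₀ = γ := by
    have hmγ : m x₀ ≤ γ := (sInf_le (Set.mem_image_of_mem _ hy₀)).trans hle
    refine hmγ.antisymm (ge_of_tendsto hm ?_)
    filter_upwards [hnear] with x hx
    exact le_sInf (Set.forall_mem_image.2 fun y hy => (hleft x hx y hy).le)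
  have htend : Tendsto (fun x => (x, (m x).toReal)) (𝓝[<] x₀) (𝓝 (x₀, γ)) := by
    refine (tendsto_id.mono_right nhdsWithin_le_nhds).prodMk_nhds ?_
    have hγ := (EReal.tendsto_toReal (a := γ) (by simp) (by simp)).comp (hγm ▸ hm)
    simpa only [EReal.toReal_coe, Function.comp_def] using hγ
  refine htend.frequently (Filter.Eventually.frequently ?_)
  filter_upwards [hnear, hm.eventually_lt (hcont y₁) (hγm.trans_lt hside₁),
    hm.eventually_lt (hcont y₂) (hγm.trans_lt hside₂)] with x hx hlt₁ hlt₂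
  obtain ⟨y, hy, hmy, hmin⟩ := isCompact_Icc.exists_sInf_image_eq_and_le ⟨y₀, hy₀⟩
    (hh.comp (.prodMk_right x)).continuousOn
  change m x = h x y at hmy
  have hmγ : γ < m x := hmy ▸ hleft x hx y hy
  have hmx : ((m x).toReal : EReal) = m x :=
    EReal.coe_toReal (hlt₁.trans_le le_top).ne ((EReal.bot_lt_coe γ).trans hmγ).ne'
  refine ⟨by rwa [← EReal.coe_lt_coe_iff, hmx], y, hmy.symm.trans hmx.symm, ?_⟩
  refine IsMinOn.isLocalMin (s := Set.Icc y₁ y₂) hmin (Icc_mem_nhds ?_ ?_)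
  · exact hy.1.lt_of_ne (by rintro rfl; exact hlt₁.ne hmy)
  · exact hy.2.lt_of_ne (by rintro rfl; exact hlt₂.ne hmy)

end LocalMin

section AlgebraicLevels

open Polynomial

/-- The levels `σ > 0` of `h` on the parallel curves `y ↦ (x, y)` are algebraic: `h x y = σ` implies
a polynomial equation `P = 0` in `x`, `σ ^ 2` and `w y`, where `w` parametrizes the common shape of
the curves (a line or a circle). -/
structure HasAlgebraicLevels (h : ℝ → ℝ → EReal) (w : ℝ → ℂ) (P : ℂ[X][X][X]) : Prop where
  continuous_uncurry : Continuous (Function.uncurry h)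
  contDiff : ContDiff ℝ 1 w
  deriv_ne_zero : ∀ y, deriv w y ≠ 0
  eval_eq_zero : ∀ x y σ : ℝ, 0 < σ → h x y = σ → evalHom₃ x (σ ^ 2 : ℝ) (w y) P = 0

/-- The parameters of the points on the curve with parameter `x` at which the polynomial equation
for the level `σ` holds. In both algorithms this is the set of eigenvalues of the search pencil. -/
def levelZeros (P : ℂ[X][X][X]) (w : ℝ → ℂ) (σ x : ℝ) : Set ℝ :=
  {y | evalHom₃ x (σ ^ 2 : ℝ) (w y) P = 0}

theorem levelZeros_eq_preimage (P : ℂ[X][X][X]) (w : ℝ → ℂ) (σ x : ℝ) : levelZeros P w σ x =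
    w ⁻¹' {z | (P.map (evalEvalRingHom (x : ℂ) (σ ^ 2 : ℝ))).IsRoot z} := by
  ext y
  simp only [levelZeros, evalHom₃_eq_eval_map, Set.mem_ofPred_eq, Set.mem_preimage, IsRoot.def]

variable {h : ℝ → ℝ → EReal} {w : ℝ → ℂ} {P : ℂ[X][X][X]} {σ γ x₀ y₀ η : ℝ}

theorem finite_isRoot_of_notMem_levelZeros (hy₀ : y₀ ∉ levelZeros P w σ x₀) :
    {z | (P.map (evalEvalRingHom (x₀ : ℂ) (σ ^ 2 : ℝ))).IsRoot z}.Finite := by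
  refine finite_setOfPred_isRoot fun hzero => hy₀ ?_
  simp only [levelZeros_eq_preimage, hzero, IsRoot.def, eval_zero, Set.preimage_ofPred_eq,
    Set.mem_ofPred_eq]

theorem eventually_notMem_levelZeros (hy₀ : y₀ ∉ levelZeros P w σ x₀) (η : ℝ) :
    ∀ᶠ x in 𝓝[<] η, y₀ ∉ levelZeros P w σ x := by
  obtain ⟨d, hd⟩ := exists_evalHom₃_eq_eval P (σ ^ 2 : ℝ) (w y₀)
  have hd₀ : d ≠ 0 := by
    rintro rfl
    exact hy₀ ((hd x₀).symm.trans eval_zero)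
  filter_upwards [nhdsWithin_mono η (fun x (hx : x < η) => hx.ne)
    (eventually_nhdsNE_eval_ofReal_ne_zero hd₀ η)] with x hx hmem
  exact hx ((hd x).trans hmem)

namespace HasAlgebraicLevels

theorem continuous_left (hP : HasAlgebraicLevels h w P) (y : ℝ) : Continuous fun x => h x y :=
  hP.continuous_uncurry.comp (.prodMk_left y)

theorem continuous_right (hP : HasAlgebraicLevels h w P) (x : ℝ) : Continuous (h x) :=
  hP.continuous_uncurry.comp (.prodMk_right x)

theorem hasDerivAt (hP : HasAlgebraicLevels h w P) (y : ℝ) : HasDerivAt w (deriv w y) y :=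
  (hP.contDiff.differentiable one_ne_zero y).hasDerivAt

theorem isClosed_levelZeros (hP : HasAlgebraicLevels h w P) (σ x : ℝ) :
    IsClosed (levelZeros P w σ x) :=
  isClosed_singleton.preimage ((continuous_evalHom₃ P).comp
    (continuous_const.prodMk (continuous_const.prodMk hP.contDiff.continuous)))

theorem dense_compl_levelZeros (hP : HasAlgebraicLevels h w P)
    (hy₀ : y₀ ∉ levelZeros P w σ x₀) : Dense (levelZeros P w σ x₀)ᶜ := by
  rw [levelZeros_eq_preimage]
  exact dense_compl_preimage_of_deriv_ne_zero hP.hasDerivAt hP.deriv_ne_zero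
    (finite_isRoot_of_notMem_levelZeros hy₀)

theorem exists_mem_Ioo_eventually_ne (hP : HasAlgebraicLevels h w P) (hγ : 0 < γ)
    (hy₀ : y₀ ∉ levelZeros P w γ x₀) (η : ℝ) {a b : ℝ} (hab : a < b) :
    ∃ y ∈ Set.Ioo a b, ∀ᶠ x in 𝓝[<] η, h x y ≠ γ := by
  obtain ⟨y, hy, hyab⟩ := (hP.dense_compl_levelZeros hy₀).exists_between hab
  refine ⟨y, hyab, (eventually_notMem_levelZeros hy η).mono fun x hx hlevel => ?_⟩
  exact hx (hP.eval_eq_zero x y γ hγ hlevel)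

theorem not_isLocalMin_of_simple_zeros (hP : HasAlgebraicLevels h w P) {Q : ℂ[X][X][X]}
    (hσ : 0 < σ) (hlevel : h x₀ y₀ = σ)
    (hQ : ∀ᶠ s in 𝓝 (σ ^ 2), ∀ y, evalHom₃ x₀ (s : ℝ) (w y) P = 0 →
      evalHom₃ x₀ (s : ℝ) (w y) Q = 0)
    (hQ' : evalHom₃ x₀ (σ ^ 2 : ℝ) (w y₀) (derivative Q) ≠ 0) : ¬ IsLocalMin (h x₀) y₀ := by
  intro hmin
  have hcont := hP.continuous_right x₀
  set u : ℝ → ℝ := fun y => (h x₀ y).toReal ^ 2 with hu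
  have huy₀ : u y₀ = σ ^ 2 := by simp [hu, hlevel]
  have hfin := eventually_exists_pos_eq_coe hcont.continuousAt hσ hlevel
  have hucont : ∀ᶠ y in 𝓝 y₀, ContinuousAt u y := by
    filter_upwards [hfin] with y ⟨τ, _, hy⟩
    refine ContinuousAt.pow ((EReal.tendsto_toReal ?_ ?_).comp hcont.continuousAt) 2 <;> simp [hy]
  refine not_isLocalMin_of_eventually_eq_zero (u := u) (y₀ := y₀)
    (Φ := fun y s => evalHom₃ x₀ s (w y) Q)
    (Φ' := fun y s => evalHom₃ x₀ s (w y) (derivative Q) * deriv w y) ?_ ?_ ?_ hucont ?_ ?_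
  · intro y s
    simpa only [evalHom₃_eq_eval_map, derivative_map, Function.comp_def] using
      ((Q.map (evalEvalRingHom (x₀ : ℂ) s)).hasDerivAt (w y)).comp y (hP.hasDerivAt y)
  · have hw := hP.contDiff.continuous
    have hw' := hP.contDiff.continuous_deriv le_rfl
    exact (((continuous_evalHom₃ (derivative Q)).comp
      (f := fun z : ℝ × ℝ => ((x₀ : ℂ), (z.2 : ℂ), w z.1)) (by fun_prop)).mul
        (hw'.comp continuous_fst)).continuousAt
  · exact mul_ne_zero (by rwa [huy₀]) (hP.deriv_ne_zero y₀)
  · filter_upwards [hfin, hucont.self_of_nhds.eventually (huy₀ ▸ hQ)] with y ⟨τ, hτ, hy⟩ hQy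
    exact hQy y (by simpa [hu, hy] using hP.eval_eq_zero x₀ y τ hτ hy)
  · filter_upwards [hmin, hfin] with y hle ⟨τ, hτ, hy⟩
    rw [hlevel, hy, EReal.coe_le_coe_iff] at hle
    simpa [hu, hlevel, hy] using pow_le_pow_left₀ hσ.le hle 2

theorem exists_ne_zero_of_isLocalMin (hP : HasAlgebraicLevels h w P) (hP₀ : P ≠ 0) :
    ∃ e : ℂ[X][X], e ≠ 0 ∧ ∀ x y σ : ℝ, 0 < σ → h x y = σ → IsLocalMin (h x) y →
      e.evalEval (x : ℂ) ((σ ^ 2 : ℝ) : ℂ) = 0 := by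
  obtain ⟨Q, e, he, hQ⟩ := exists_simple_zeros (F := ℂ) hP₀
  refine ⟨e, he, fun x y σ hσ hlevel hmin => ?_⟩
  by_contra hne
  have hzero := hP.eval_eq_zero x y σ hσ hlevel
  have hev : ∀ᶠ s : ℝ in 𝓝 (σ ^ 2), e.evalEval (x : ℂ) (s : ℂ) ≠ 0 :=
    ((continuous_evalEval e).comp (f := fun s : ℝ => ((x : ℂ), (s : ℂ)))
      (by fun_prop)).continuousAt.eventually_ne hne
  refine hP.not_isLocalMin_of_simple_zeros (Q := Q) hσ hlevel ?_ ?_ hmin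
  · exact hev.mono fun s hs y hy => (hQ (evalEvalRingHom x s) (w y) hs hy).1
  · exact (hQ (evalEvalRingHom x (σ ^ 2 : ℝ)) (w y) hne hzero).2

theorem eventually_not_isLocalMin (hP : HasAlgebraicLevels h w P) (hP₀ : P ≠ 0) (hγ : 0 < γ)
    (η : ℝ) : ∀ᶠ x in 𝓝[<] η, ∀ᶠ z : ℝ × ℝ in 𝓝 (x, γ),
      ¬ (γ < z.2 ∧ ∃ y, h z.1 y = z.2 ∧ IsLocalMin (h z.1) y) := by
  obtain ⟨e, he, hmin⟩ := hP.exists_ne_zero_of_isLocalMin hP₀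
  filter_upwards [eventually_evalEval_sq_ne_zero he hγ η] with x hx
  filter_upwards [hx] with z hz ⟨hγz, y, hlevel, hy⟩
  exact hz hγz (hmin z.1 y z.2 (hγ.trans hγz) hlevel hy)

theorem eventually_forall_lt_of_boundary_lt (hP : HasAlgebraicLevels h w P) (hP₀ : P ≠ 0)
    (hγ : 0 < γ) (η : ℝ) : ∀ᶠ x in 𝓝[<] η, ∀ t ∈ Set.Ico x η, ∀ y₁ y₂,
      (∀ y ∈ Set.Icc y₁ y₂, γ < h x y) → (∀ s ∈ Set.Icc x t, γ < h s y₁ ∧ γ < h s y₂) →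
        ∀ y ∈ Set.Icc y₁ y₂, γ < h t y := by
  filter_upwards [eventually_nhdsLT_forall_Ico (hP.eventually_not_isLocalMin hP₀ hγ η)]
    with x hx t ht y₁ y₂ hleft hside
  by_contra! hbad
  obtain ⟨x₀, hx₀, hcontact, hfirst⟩ :=
    exists_first_contact hP.continuous_uncurry ht.1 hleft hbad
  have hside₀ := hside x₀ ⟨hx₀.1.le, hx₀.2⟩
  exact frequently_isLocalMin_of_first_contact hP.continuous_uncurry hx₀.1 hfirst hside₀.1
    hside₀.2 hcontact (hx x₀ ⟨hx₀.1.le, hx₀.2.trans_lt ht.2⟩)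

/-- To the left of `η` the level set avoids two lines `y = y₁` and `y = y₂`, one on either side of
the midpoint, and no contact with the level can occur between them. -/
theorem eventually_lt_midpoint (hP : HasAlgebraicLevels h w P) (hγ : 0 < γ)
    (hy₀ : y₀ ∉ levelZeros P w γ x₀) (η : ℝ) {c₀ d₀ : ℝ} (hcd : c₀ < d₀) :
    ∀ᶠ z : ℝ × ℝ × ℝ in 𝓝[<] η ×ˢ 𝓝 (c₀, d₀), (∀ y ∈ Set.Ioo z.2.1 z.2.2, γ < h z.1 y) →
      ∀ t ∈ Set.Ico z.1 η, γ < h t ((z.2.1 + z.2.2) / 2) := by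
  have hP₀ : P ≠ 0 := by
    rintro rfl
    exact hy₀ (map_zero _)
  obtain ⟨y₁, hy₁, hne₁⟩ := hP.exists_mem_Ioo_eventually_ne hγ hy₀ η
    (show c₀ < (c₀ + d₀) / 2 by linarith)
  obtain ⟨y₂, hy₂, hne₂⟩ := hP.exists_mem_Ioo_eventually_ne hγ hy₀ η
    (show (c₀ + d₀) / 2 < d₀ by linarith)
  have hnear : ∀ᶠ z : ℝ × ℝ in 𝓝 (c₀, d₀),
      (z.1 < y₁ ∧ z.2 > y₂) ∧ (z.1 + z.2) / 2 ∈ Set.Ioo y₁ y₂ :=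
    ((continuousAt_fst.eventually (gt_mem_nhds hy₁.1)).and
      (continuousAt_snd.eventually (lt_mem_nhds hy₂.2))).and
      ((by fun_prop : ContinuousAt (fun z : ℝ × ℝ => (z.1 + z.2) / 2) (c₀, d₀)).eventually
        (Ioo_mem_nhds hy₁.2 hy₂.1))
  filter_upwards [((hP.eventually_forall_lt_of_boundary_lt hP₀ hγ η).and
    (eventually_nhdsLT_forall_Ico (hne₁.and hne₂))).prod_mk hnear]
    with ⟨x, c, d⟩ ⟨⟨htrap, hne⟩, ⟨hc, hd⟩, hm⟩ hleft t ht
  have hbox : ∀ y ∈ Set.Icc y₁ y₂, γ < h x y := fun y hy =>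
    hleft y ⟨hc.trans_le hy.1, hy.2.trans_lt hd⟩
  have hy₁₂ : y₁ ≤ y₂ := (hm.1.trans hm.2).le
  have hside : ∀ y, (γ : EReal) < h x y → (∀ s ∈ Set.Ico x η, h s y ≠ γ) →
      ∀ s ∈ Set.Ico x η, γ < h s y := fun y hy hne =>
    lt_on_of_ne isPreconnected_Ico (hP.continuous_left y).continuousOn hne
      (Set.left_mem_Ico.2 (ht.1.trans_lt ht.2)) hy
  refine htrap t ht y₁ y₂ hbox (fun s hs => ?_) _ (Set.Ioo_subset_Icc_self hm)
  have hs' : s ∈ Set.Ico x η := ⟨hs.1, hs.2.trans_lt ht.2⟩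
  exact ⟨hside y₁ (hbox y₁ ⟨le_rfl, hy₁₂⟩) (fun r hr => (hne r hr).1) s hs',
    hside y₂ (hbox y₂ ⟨hy₁₂, le_rfl⟩) (fun r hr => (hne r hr).2) s hs'⟩

theorem eventually_forall_lt_midpoint (hP : HasAlgebraicLevels h w P) (hγ : 0 < γ)
    (hy₀ : y₀ ∉ levelZeros P w γ x₀) (η : ℝ) {a b δ : ℝ} (hδ : 0 < δ) :
    ∀ᶠ x in 𝓝[<] η, ∀ c ∈ Set.Icc a b, ∀ d ∈ Set.Icc a b, δ ≤ d - c →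
      (∀ y ∈ Set.Ioo c d, γ < h x y) → ∀ t ∈ Set.Ico x η, γ < h t ((c + d) / 2) := by
  have hK : IsCompact ((Set.Icc a b ×ˢ Set.Icc a b) ∩ {z : ℝ × ℝ | δ ≤ z.2 - z.1}) :=
    (isCompact_Icc.prod isCompact_Icc).inter_right
      (isClosed_le continuous_const (continuous_snd.sub continuous_fst))
  have hev := hK.mem_prod_nhdsSet_of_forall fun z hz =>
    hP.eventually_lt_midpoint hγ hy₀ η (c₀ := z.1) (d₀ := z.2)
      (by linarith [show δ ≤ z.2 - z.1 from hz.2])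
  filter_upwards [Filter.Eventually.curry hev] with x hx c hc d hd hcd
  exact hx.self_of_nhdsSet (c, d) ⟨⟨hc, hd⟩, hcd⟩

theorem eventually_exists_isCrossSection (hP : HasAlgebraicLevels h w P) (hγ : 0 < γ)
    {y₁ : ℝ} (hy₁ : y₁ ∉ levelZeros P w γ x₀) {δ : ℝ} (hδ : 0 < δ)
    (hbox : ∀ y ∈ Set.Icc (y₀ - δ) (y₀ + δ), γ < h η y) (a b : ℝ) :
    ∀ᶠ x in 𝓝[<] η, (levelZeros P w γ x ∩ Set.Icc a (y₀ - δ)).Nonempty →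
      (levelZeros P w γ x ∩ Set.Icc (y₀ + δ) b).Nonempty →
      ∃ c d, IsCrossSection (levelZeros P w γ x) (fun y => γ ≤ h x y) c d ∧
        ∀ t ∈ Set.Ico x η, γ < h t ((c + d) / 2) := by
  have hnear : ∀ᶠ x in 𝓝[<] η, ∀ y ∈ Set.Icc (y₀ - δ) (y₀ + δ), γ < h x y :=
    nhdsWithin_le_nhds (isCompact_Icc.eventually_forall_of_forall_eventually fun y hy =>
      hP.continuous_uncurry.continuousAt.eventually (lt_mem_nhds (hbox y hy)))
  filter_upwards [hP.eventually_forall_lt_midpoint hγ hy₁ η (half_pos hδ) (a := a) (b := b),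
    eventually_nhdsLT_forall_Ico hnear, eventually_notMem_levelZeros hy₁ η, self_mem_nhdsWithin]
    with x hlong hboxes hreg hxη ⟨a', ha', haa', ha'y⟩ ⟨b', hb', hyb', hbb'⟩
  obtain ⟨c, hc, d, hd, hcross, hgt, hcd⟩ := exists_isCrossSection_near (hP.continuous_right x)
    (hP.isClosed_levelZeros γ x) (hP.dense_compl_levelZeros hreg)
    (fun y => hP.eval_eq_zero x y γ hγ) hδ (hboxes x ⟨le_rfl, hxη⟩) ha' hb' ha'y hyb'
  refine ⟨c, d, hcross, fun t ht => ?_⟩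
  rcases hcd with hcd | hsub
  · exact hlong c (Set.Icc_subset_Icc haa' hbb' hc) d (Set.Icc_subset_Icc haa' hbb' hd) hcd hgt t ht
  · have hlt := hcross.2.2.1
    exact hboxes t ht _ (hsub ⟨by linarith, by linarith⟩)

theorem exists_forall_mem_Icc_lt (hP : HasAlgebraicLevels h w P) (h₀ : γ < h η y₀) :
    ∃ δ > 0, ∀ y ∈ Set.Icc (y₀ - δ) (y₀ + δ), γ < h η y := by
  obtain ⟨δ, hδ, hball⟩ := Metric.nhds_basis_closedBall.mem_iff.1
    ((hP.continuous_right η).continuousAt.eventually_const_lt h₀)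
  exact ⟨δ, hδ, fun y hy => hball (by rwa [Real.closedBall_eq_Icc])⟩

/-- The conclusion says that a search step from `u k` which includes the midpoint of the
cross section cannot end at `u (k + 1)`. -/
theorem eventually_exists_isCrossSection_of_monotone (hP : HasAlgebraicLevels h w P) (hγ : 0 < γ)
    {u : ℕ → ℝ} (hmono : Monotone u) (hlim : Tendsto u atTop (𝓝 η)) {δ : ℝ} (hδ : 0 < δ)
    (hbox : ∀ y ∈ Set.Icc (y₀ - δ) (y₀ + δ), γ < h η y) (a b : ℝ) :
    ∀ᶠ k in atTop, (levelZeros P w γ (u k))ᶜ.Nonempty →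
      (levelZeros P w γ (u k) ∩ Set.Icc a (y₀ - δ)).Nonempty →
      (levelZeros P w γ (u k) ∩ Set.Icc (y₀ + δ) b).Nonempty →
      ∃ c d, IsCrossSection (levelZeros P w γ (u k)) (fun y => γ ≤ h (u k) y) c d ∧
        ∀ t ∈ Set.Icc (u k) (u (k + 1)), γ < h t ((c + d) / 2) := by
  have hle : ∀ k, u k ≤ η := hmono.ge_of_tendsto hlim
  by_cases hreached : ∃ k, u k = η
  · obtain ⟨k₀, hk₀⟩ := hreached
    have hconst : ∀ k ≥ k₀, u k = η := fun k hk => (hle k).antisymm (hk₀ ▸ hmono hk)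
    filter_upwards [eventually_ge_atTop k₀] with k hk
    rw [hconst k hk, hconst (k + 1) (by lia)]
    rintro ⟨y₁, hy₁⟩ ⟨a', ha', -, ha'y⟩ ⟨b', hb', hyb', -⟩
    obtain ⟨c, -, d, -, hcross, hgt, -⟩ := exists_isCrossSection_near (hP.continuous_right η)
      (hP.isClosed_levelZeros γ η) (hP.dense_compl_levelZeros hy₁)
      (fun y => hP.eval_eq_zero η y γ hγ) hδ hbox ha' hb' ha'y hyb'
    have hcd := hcross.2.2.1
    refine ⟨c, d, hcross, fun t ht => ?_⟩
    rw [le_antisymm ht.2 ht.1]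
    exact hgt _ ⟨by linarith, by linarith⟩
  · have hlt : ∀ k, u k < η := fun k => (hle k).lt_of_ne fun hk => hreached ⟨k, hk⟩
    by_cases hreg : ∃ x y, y ∉ levelZeros P w γ x
    · obtain ⟨x, y, hy⟩ := hreg
      filter_upwards [(tendsto_nhdsWithin_iff.2 ⟨hlim, .of_forall hlt⟩).eventually
        (hP.eventually_exists_isCrossSection hγ hy hδ hbox a b)] with k hk _ hleft hright
      obtain ⟨c, d, hcross, hgt⟩ := hk hleft hright
      exact ⟨c, d, hcross, fun t ht => hgt t ⟨ht.1, ht.2.trans_lt (hlt _)⟩⟩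
    · exact .of_forall fun k ⟨y, hy⟩ => absurd ⟨_, y, hy⟩ hreg

end HasAlgebraicLevels

end AlgebraicLevels

section Matrix

variable {ι κ : Type*} [Fintype ι] [DecidableEq ι]

theorem isUnit_matrix_iff_det_ne_zero (M : Matrix ι ι ℂ) : IsUnit M ↔ M.det ≠ 0 := by
  rw [Matrix.isUnit_iff_isUnit_det, isUnit_iff_ne_zero]

open scoped MatrixOrder ComplexOrder in
theorem det_norm_sq_sub_conjTranspose_mul_self [Fintype κ] (M : Matrix κ ι ℂ) (hM : 0 < ‖M‖) :
    (((‖M‖ ^ 2 : ℝ) : ℂ) • 1 - Mᴴ * M).det = 0 := by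
  have hnontrivial : Nontrivial (Matrix ι ι ℂ) :=
    nontrivial_of_ne (Mᴴ * M) 0 fun h => by
      have hnorm := Matrix.l2_opNorm_conjTranspose_mul_self M
      rw [h, norm_zero] at hnorm
      exact (mul_pos hM hM).ne hnorm
  have hmem := CStarAlgebra.norm_mem_spectrum_of_nonneg (a := Mᴴ * M)
    (Matrix.posSemidef_conjTranspose_mul_self M).nonneg
  rwa [Matrix.l2_opNorm_conjTranspose_mul_self, spectrum.mem_iff, isUnit_matrix_iff_det_ne_zero,
    not_not, Algebra.algebraMap_eq_smul_one, ← sq, ← Complex.coe_smul] at hmem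

theorem det_sq_sub_conjTranspose_mul_self_ne_zero [Fintype κ] (M : Matrix κ ι ℂ) {γ : ℝ}
    (hM : ‖M‖ < γ) : (((γ ^ 2 : ℝ) : ℂ) • 1 - Mᴴ * M).det ≠ 0 := by
  rcases isEmpty_or_nonempty ι with h | h
  · simp
  rw [← isUnit_matrix_iff_det_ne_zero, ← Algebra.algebraMap_eq_smul_one]
  by_contra hmem
  have hle := spectrum.norm_le_norm_of_mem (spectrum.mem_iff.2 hmem)
  rw [Matrix.l2_opNorm_conjTranspose_mul_self, Complex.norm_real,
    Real.norm_of_nonneg (by positivity)] at hle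
  nlinarith [norm_nonneg M]

theorem isUnit_one_sub_mul_of_norm_lt_inv [Fintype κ] [DecidableEq κ] {M : Matrix ι κ ℂ}
    {Δ : Matrix κ ι ℂ} {ε : ℝ} (hM : ‖M‖ < ε⁻¹) (hΔ : ‖Δ‖ ≤ ε) : IsUnit (1 - M * Δ) := by
  have hε : 0 < ε := inv_pos.1 ((norm_nonneg M).trans_lt hM)
  refine isUnit_one_sub_of_norm_lt_one ((Matrix.l2_opNorm_mul M Δ).trans_lt ?_)
  calc ‖M‖ * ‖Δ‖ ≤ ‖M‖ * ε := by gcongr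
    _ < ε⁻¹ * ε := by gcongr
    _ = 1 := inv_mul_cancel₀ hε.ne'

theorem exists_norm_eq_inv_det_one_sub_mul_eq_zero [Fintype κ] [DecidableEq κ] (M : Matrix ι κ ℂ)
    (hM : 0 < ‖M‖) : ∃ Δ : Matrix κ ι ℂ, ‖Δ‖ = ‖M‖⁻¹ ∧ (1 - M * Δ).det = 0 := by
  set c : ℂ := ((‖M‖ ^ 2 : ℝ) : ℂ) with hc
  have hc₀ : c ≠ 0 := by
    rw [hc]
    exact_mod_cast (pow_pos hM 2).ne'
  refine ⟨c⁻¹ • Mᴴ, ?_, ?_⟩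
  · rw [norm_smul, Matrix.l2_opNorm_conjTranspose, norm_inv, hc, Complex.norm_real,
      Real.norm_of_nonneg (by positivity), sq, mul_inv, mul_assoc, inv_mul_cancel₀ hM.ne', mul_one]
  · have hfactor : 1 - M * (c⁻¹ • Mᴴ) = c⁻¹ • (c • 1 - M * Mᴴ) := by
      rw [smul_sub, smul_smul, inv_mul_cancel₀ hc₀, one_smul, Matrix.mul_smul]
    have hdet := det_norm_sq_sub_conjTranspose_mul_self Mᴴ
      (by rwa [Matrix.l2_opNorm_conjTranspose])
    rw [Matrix.l2_opNorm_conjTranspose, Matrix.conjTranspose_conjTranspose, ← hc] at hdet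
    rw [hfactor, Matrix.det_smul, hdet, mul_zero]

theorem continuousAt_matrix_nonsing_inv {M : Matrix ι ι ℂ} (hM : M.det ≠ 0) :
    ContinuousAt (fun N : Matrix ι ι ℂ => N⁻¹) M :=
  continuousAt_matrix_inv M (by
    simpa only [Ring.inverse_eq_inv'] using continuousAt_inv₀ hM)

theorem meromorphicAt_det {N : ℂ → Matrix ι ι ℂ} {z : ℂ}
    (hN : ∀ i j, MeromorphicAt (fun w => N w i j) z) : MeromorphicAt (fun w => (N w).det) z := by
  simp only [Matrix.det_apply']
  exact .fun_sum fun σ _ => (MeromorphicAt.const _ z).mul (.fun_prod fun i _ => hN (σ i) i)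

theorem meromorphicAt_inv_apply {N : ℂ → Matrix ι ι ℂ} {z : ℂ}
    (hN : ∀ i j, MeromorphicAt (fun w => N w i j) z) (i j : ι) :
    MeromorphicAt (fun w => (N w)⁻¹ i j) z := by
  simp only [Matrix.inv_def, Ring.inverse_eq_inv', Matrix.smul_apply, smul_eq_mul,
    Matrix.adjugate_apply]
  refine (meromorphicAt_det hN).inv.mul (meromorphicAt_det fun k l => ?_)
  obtain rfl | hk := eq_or_ne k j
  · simpa only [Matrix.updateRow_self] using .const _ z
  · simpa only [Matrix.updateRow_ne hk] using hN k l

theorem meromorphicAt_of_forall_apply [Fintype κ] {N : ℂ → Matrix κ ι ℂ} {z : ℂ}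
    (hN : ∀ i j, MeromorphicAt (fun w => N w i j) z) : MeromorphicAt N z := by
  classical
  have hsum : N = fun w => ∑ i, ∑ j, N w i j • Matrix.single i j (1 : ℂ) := by
    funext w
    simpa only [Matrix.smul_single, smul_eq_mul, mul_one] using Matrix.matrix_eq_sum_single (N w)
  rw [hsum]
  exact .fun_sum fun i _ => .fun_sum fun j _ => (hN i j).smul (.const _ z)

end Matrix

namespace LTISystem

variable {n m p : ℕ} (S : LTISystem n m p) {z : ℂ} {γ : ℝ}

theorem notMem_eig_iff : z ∉ S.eig ↔ IsUnit (z • S.E - S.A) :=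
  (isUnit_matrix_iff_det_ne_zero _).symm

theorem eig_eq_spectrum (hE : IsUnit S.E) : S.eig = spectrum ℂ (S.E⁻¹ * S.A) := by
  ext z
  have hfactor : z • S.E - S.A = S.E * (z • 1 - S.E⁻¹ * S.A) := by
    rw [mul_sub, ← mul_assoc, Matrix.mul_nonsing_inv _ ((Matrix.isUnit_iff_isUnit_det _).1 hE),
      one_mul, Matrix.mul_smul, mul_one]
  rw [← not_iff_not, notMem_eig_iff, spectrum.notMem_iff, Algebra.algebraMap_eq_smul_one, hfactor,
    hE.mul_left_iff]

theorem finite_eig (hE : IsUnit S.E) : S.eig.Finite := by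
  rw [S.eig_eq_spectrum hE]
  exact Matrix.finite_spectrum _

theorem nonempty_eig (hn : 0 < n) (hE : IsUnit S.E) : S.eig.Nonempty := by
  have : Nonempty (Fin n) := ⟨⟨0, hn⟩⟩
  rw [S.eig_eq_spectrum hE]
  exact spectrum.nonempty_of_isAlgClosed_of_finiteDimensional ℂ _

theorem eventually_notMem_eig (hE : IsUnit S.E) (z : ℂ) : ∀ᶠ w in 𝓝[≠] z, w ∉ S.eig := by
  filter_upwards [nhdsNE_of_nhdsNE_sdiff_finite univ_mem (S.finite_eig hE)] with w hw using hw.2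

theorem continuousAt_transfer (hz : z ∉ S.eig) : ContinuousAt S.transfer z := by
  have hinv : ContinuousAt (fun w : ℂ => (w • S.E - S.A)⁻¹) z :=
    (continuousAt_matrix_nonsing_inv hz).comp (f := fun w : ℂ => w • S.E - S.A) (by fun_prop)
  have hsandwich : Continuous fun X : Matrix (Fin n) (Fin n) ℂ => S.C * X * S.B + S.D := by fun_prop
  exact hsandwich.continuousAt.comp (f := fun w : ℂ => (w • S.E - S.A)⁻¹) hinv

theorem meromorphicAt_transfer (z : ℂ) : MeromorphicAt S.transfer z := by
  have hinv := meromorphicAt_inv_apply (N := fun w : ℂ => w • S.E - S.A) (z := z) fun i j =>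
    ((MeromorphicAt.id z).mul (.const (S.E i j) z)).sub (.const (S.A i j) z)
  refine meromorphicAt_of_forall_apply fun i j => ?_
  simp only [transfer, Matrix.add_apply, Matrix.mul_apply]
  exact (MeromorphicAt.fun_sum fun k _ => (MeromorphicAt.fun_sum fun l _ =>
    (MeromorphicAt.const _ z).mul (hinv l k)).mul (.const _ z)).add (.const _ z)

theorem transfer_eq_of_ne_zero (hz : z ≠ 0) (hdet : (S.E - z⁻¹ • S.A).det ≠ 0) :
    S.transfer z = S.C * (z⁻¹ • (S.E - z⁻¹ • S.A)⁻¹) * S.B + S.D := by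
  have hfactor : z • S.E - S.A = z • (S.E - z⁻¹ • S.A) := by
    rw [smul_sub, smul_smul, mul_inv_cancel₀ hz, one_smul]
  rw [transfer, hfactor]
  congr 3
  exact Matrix.inv_smul' _ (Units.mk0 z hz) hdet.isUnit

theorem tendsto_transfer_cobounded (hE : IsUnit S.E) :
    Tendsto S.transfer (Bornology.cobounded ℂ) (𝓝 S.D) := by
  have hdet : (S.E - (0 : ℂ) • S.A).det ≠ 0 := by
    rwa [zero_smul, sub_zero, ← isUnit_matrix_iff_det_ne_zero]
  have hpencil : Continuous fun t : ℂ => S.E - t • S.A := by fun_prop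
  have hinv : ContinuousAt (fun t : ℂ => (S.E - t • S.A)⁻¹) 0 :=
    (continuousAt_matrix_nonsing_inv hdet).comp (f := fun t : ℂ => S.E - t • S.A)
      hpencil.continuousAt
  have hlim : Tendsto (fun t : ℂ => S.C * (t • (S.E - t • S.A)⁻¹) * S.B + S.D) (𝓝 0) (𝓝 S.D) := by
    have hsandwich : Continuous fun X : Matrix (Fin n) (Fin n) ℂ => S.C * X * S.B + S.D := by
      fun_prop
    simpa [Function.comp_def] using (hsandwich.tendsto _).comp (continuousAt_id.smul hinv).tendsto
  refine (hlim.comp tendsto_inv₀_cobounded).congr' ?_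
  filter_upwards [tendsto_inv₀_cobounded.eventually
      (hpencil.matrix_det.continuousAt.eventually_ne hdet),
    Bornology.isBounded_def.1 (Bornology.isBounded_singleton (x := (0 : ℂ)))] with z hz hz₀
  exact (S.transfer_eq_of_ne_zero hz₀ hz).symm

theorem ntf_of_notMem (hz : z ∉ S.eig) : S.ntf z = ((‖S.transfer z‖ : ℝ) : EReal) :=
  if_neg hz

theorem ntf_eq_top_or_exists_tendsto_transfer (z : ℂ) :
    (S.ntf z = ⊤ ∧ Tendsto (fun w => ((‖S.transfer w‖ : ℝ) : EReal)) (𝓝[≠] z) (𝓝 ⊤)) ∨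
      ∃ G, Tendsto S.transfer (𝓝[≠] z) (𝓝 G) ∧ S.ntf z = ((‖G‖ : ℝ) : EReal) := by
  by_cases hz : z ∉ S.eig
  · exact .inr ⟨S.transfer z, (S.continuousAt_transfer hz).tendsto.mono_left nhdsWithin_le_nhds,
      S.ntf_of_notMem hz⟩
  rw [ntf, if_pos (not_not.1 hz)]
  rcases lt_or_ge (meromorphicOrderAt S.transfer z) 0 with h | h
  · have htop : Tendsto (fun w => ((‖S.transfer w‖ : ℝ) : EReal)) (𝓝[≠] z) (𝓝 ⊤) :=
      EReal.tendsto_coe_atTop.comp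
        (tendsto_norm_cobounded_atTop.comp (tendsto_cobounded_of_meromorphicOrderAt_neg h))
    exact .inl ⟨htop.limsup_eq, htop⟩
  · obtain ⟨G, hG⟩ := tendsto_nhds_of_meromorphicOrderAt_nonneg (S.meromorphicAt_transfer z) h
    exact .inr ⟨G, hG, ((continuous_coe_real_ereal.tendsto _).comp hG.norm).limsup_eq⟩

theorem tendsto_norm_transfer (z : ℂ) :
    Tendsto (fun w => ((‖S.transfer w‖ : ℝ) : EReal)) (𝓝[≠] z) (𝓝 (S.ntf z)) := by
  rcases S.ntf_eq_top_or_exists_tendsto_transfer z with ⟨hz, htop⟩ | ⟨G, hG, hz⟩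
  · rwa [hz]
  · rw [hz]
    exact (continuous_coe_real_ereal.tendsto _).comp hG.norm

theorem continuous_ntf (hE : IsUnit S.E) : Continuous S.ntf := by
  refine continuous_iff_continuousAt.2 fun z => continuousAt_iff_punctured_nhds.2 ?_
  refine (S.tendsto_norm_transfer z).congr' ?_
  filter_upwards [S.eventually_notMem_eig hE z] with w hw using (S.ntf_of_notMem hw).symm

/-- The poles of the transfer function. -/
def poles : Set ℂ := {z | S.ntf z = ⊤}

theorem poles_subset_eig : S.poles ⊆ S.eig := by
  intro z hz
  by_contra hzE
  exact EReal.coe_ne_top _ ((S.ntf_of_notMem hzE).symm.trans hz)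

/-- The transfer function with its removable singularities removed; the values at the poles are
junk. -/
noncomputable def transferExt (z : ℂ) : Matrix (Fin p) (Fin m) ℂ := limUnder (𝓝[≠] z) S.transfer

theorem transferExt_of_notMem (hz : z ∉ S.eig) : S.transferExt z = S.transfer z :=
  ((S.continuousAt_transfer hz).tendsto.mono_left nhdsWithin_le_nhds).limUnder_eq

theorem tendsto_transferExt (hz : z ∉ S.poles) :
    Tendsto S.transfer (𝓝[≠] z) (𝓝 (S.transferExt z)) := by
  rcases S.ntf_eq_top_or_exists_tendsto_transfer z with ⟨htop, -⟩ | ⟨G, hG, -⟩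
  · exact absurd htop hz
  · exact tendsto_nhds_limUnder ⟨G, hG⟩

theorem ntf_eq_norm_transferExt (hz : z ∉ S.poles) :
    S.ntf z = ((‖S.transferExt z‖ : ℝ) : EReal) :=
  tendsto_nhds_unique (S.tendsto_norm_transfer z)
    ((continuous_coe_real_ereal.tendsto _).comp (S.tendsto_transferExt hz).norm)

theorem differentiableAt_transferExt (hE : IsUnit S.E) (hz : z ∉ S.poles) :
    DifferentiableAt ℂ S.transferExt z := by
  have heq : ∀ w ∉ S.eig, S.transferExt =ᶠ[𝓝 w] S.transfer := fun w hw =>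
    ((S.finite_eig hE).isClosed.isOpen_compl.eventually_mem hw).mono
      fun _ hv => S.transferExt_of_notMem hv
  refine (Complex.analyticAt_of_differentiable_on_punctured_nhds_of_continuousAt ?_
    (continuousAt_iff_punctured_nhds.2 ?_)).differentiableAt
  · filter_upwards [S.eventually_notMem_eig hE z] with w hw
    exact (heq w hw).differentiableAt_iff.2 ((S.meromorphicAt_transfer w).analyticAt
      (S.continuousAt_transfer hw)).differentiableAt
  · refine (S.tendsto_transferExt hz).congr' ?_
    filter_upwards [S.eventually_notMem_eig hE z] with w hw using (S.transferExt_of_notMem hw).symm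

theorem exists_forall_ntf_lt (hE : IsUnit S.E) (hD : ‖S.D‖ < γ) :
    ∃ M : ℝ, ∀ z : ℂ, M ≤ ‖z‖ → z ∉ S.eig ∧ S.ntf z < γ := by
  have hlarge : ∀ᶠ z in Bornology.cobounded ℂ, z ∉ S.eig ∧ S.ntf z < γ := by
    filter_upwards [(S.tendsto_transfer_cobounded hE).norm.eventually_lt_const hD,
      Bornology.isBounded_def.1 (S.finite_eig hE).isBounded] with z hz hzE
    rw [S.ntf_of_notMem hzE]
    exact ⟨hzE, EReal.coe_lt_coe_iff.2 hz⟩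
  rw [← comap_norm_atTop] at hlarge
  obtain ⟨M, hM⟩ := eventually_atTop.1 (eventually_comap.1 hlarge)
  exact ⟨M, fun z hz => hM ‖z‖ hz z rfl⟩

end LTISystem

section Matrix

variable {ι : Type*} [Fintype ι] [DecidableEq ι]

theorem det_fromBlocks_smul_eq_zero_iff (A P Q D : Matrix ι ι ℂ) {γ c : ℂ} (hγ : γ ≠ 0)
    (hc : c ≠ 0) :
    (Matrix.fromBlocks A (γ • P) (-((c * γ) • Q)) (-(c • D))).det = 0 ↔
      (Matrix.fromBlocks A P (γ ^ 2 • Q) D).det = 0 := by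
  have hrescale : Matrix.fromBlocks A (γ • P) (-((c * γ) • Q)) (-(c • D)) =
      Matrix.fromBlocks (γ • (1 : Matrix ι ι ℂ)) 0 0 ((-c) • (1 : Matrix ι ι ℂ)) *
        Matrix.fromBlocks A P (γ ^ 2 • Q) D *
          Matrix.fromBlocks (γ⁻¹ • (1 : Matrix ι ι ℂ)) 0 0 (1 : Matrix ι ι ℂ) := by
    have hcoeff : γ⁻¹ * (γ ^ 2 * c) = c * γ := by field_simp
    rw [Matrix.fromBlocks_multiply, Matrix.fromBlocks_multiply]
    simp [smul_smul, hγ, hcoeff]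
  rw [hrescale, Matrix.det_mul, Matrix.det_mul, Matrix.det_fromBlocks_zero₁₂,
    Matrix.det_fromBlocks_zero₁₂, Matrix.det_smul, Matrix.det_smul, Matrix.det_smul]
  simp [hγ, hc]

end Matrix

section Polar

theorem norm_polarPt (r θ : ℝ) : ‖polarPt r θ‖ = |r| := by
  rw [polarPt, norm_mul, Complex.norm_exp_ofReal_mul_I, mul_one, Complex.norm_real,
    Real.norm_eq_abs]

theorem periodic_exp_ofReal_mul_I :
    Function.Periodic (fun θ : ℝ => Complex.exp (θ * Complex.I)) (2 * Real.pi) := fun θ => by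
  simpa using Complex.exp_mul_I_periodic θ

theorem periodic_polarPt (r : ℝ) : Function.Periodic (polarPt r) (2 * Real.pi) := fun θ =>
  congrArg ((r : ℂ) * ·) (periodic_exp_ofReal_mul_I θ)

theorem exists_mem_Ico_polarPt_norm (z : ℂ) :
    ∃ θ ∈ Set.Ico 0 (2 * Real.pi), polarPt ‖z‖ θ = z := by
  obtain ⟨θ, hθ, harg⟩ := (periodic_polarPt ‖z‖).exists_mem_Ico₀ Real.two_pi_pos z.arg
  exact ⟨θ, hθ, harg.symm.trans (Complex.norm_mul_exp_arg_mul_I z)⟩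

theorem exp_mul_I_mul_star_polarPt (r θ : ℝ) :
    Complex.exp (θ * Complex.I) * star (polarPt r θ) = r := by
  rw [polarPt, Complex.star_def, map_mul, Complex.conj_ofReal, mul_left_comm, Complex.mul_conj,
    Complex.normSq_eq_norm_sq, Complex.norm_exp_ofReal_mul_I]
  simp

end Polar

namespace LTISystem

variable {n m p : ℕ} (S : LTISystem n m p) {γ : ℝ}

section SvDet

variable {R T : Type*} [CommRing R] [CommRing T] [Algebra ℂ R] [Algebra ℂ T]

/-- A determinant which, for `z` outside the spectrum, `u = 1` and `v = conj z`, is a nonzero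
multiple of `det (s I - G(z)* G(z))`, where `G` is the transfer function. It is a polynomial in its
parameters, which may therefore lie in any commutative `ℂ`-algebra. The parameter `u` scales the
second block row; on the circle `z = r w` with `|w| = 1`, the choice `u = w`, `v = r = w (conj z)`
eliminates `conj z`. -/
noncomputable def svDet (z u v s : R) : R :=
  (Matrix.fromBlocks
    (Matrix.fromBlocks (z • S.E.map (algebraMap ℂ R) - S.A.map (algebraMap ℂ R)) 0
      (-(u • (S.Cᴴ * S.C).map (algebraMap ℂ R)))
      (v • S.Eᴴ.map (algebraMap ℂ R) - u • S.Aᴴ.map (algebraMap ℂ R)))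
    (Matrix.fromRows (-S.B.map (algebraMap ℂ R)) (-(u • (S.Cᴴ * S.D).map (algebraMap ℂ R))))
    (Matrix.fromCols (-(S.Dᴴ * S.C).map (algebraMap ℂ R)) (-S.Bᴴ.map (algebraMap ℂ R)))
    (s • 1 - (S.Dᴴ * S.D).map (algebraMap ℂ R))).det

theorem map_svDet (f : R →+* T) (hf : ∀ a : ℂ, f (algebraMap ℂ R a) = algebraMap ℂ T a)
    (z u v s : R) : f (S.svDet z u v s) = S.svDet (f z) (f u) (f v) (f s) := by
  rw [svDet, svDet, RingHom.map_det]
  congr 1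
  ext (i | i) j <;> rcases j with j | j
  · rcases i with i | i <;> rcases j with j | j <;> simp [hf, -Matrix.map_mul]
  · rcases i with i | i <;> simp [hf, -Matrix.map_mul]
  · rcases j with j | j <;> simp [hf, -Matrix.map_mul]
  · simp [hf, -Matrix.map_mul, Matrix.one_apply, apply_ite f]

theorem svDet_mul (z u v s : R) : S.svDet z u (u * v) s = u ^ n * S.svDet z 1 v s := by
  have hdet : (Matrix.fromBlocks (Matrix.fromBlocks (1 : Matrix (Fin n) (Fin n) R) 0 0
      (u • (1 : Matrix (Fin n) (Fin n) R))) 0 0 (1 : Matrix (Fin m) (Fin m) R)).det = u ^ n := by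
    simp
  rw [← hdet, svDet, svDet, ← Matrix.det_mul, Matrix.fromBlocks_multiply,
    Matrix.fromBlocks_multiply, Matrix.fromBlocks_mul_fromRows]
  simp [smul_sub, smul_smul]

theorem continuous_svDet : Continuous fun q : ℂ × ℂ × ℂ => S.svDet q.1 1 q.2.1 q.2.2 := by
  unfold svDet
  refine Continuous.matrix_det (.matrix_fromBlocks (.matrix_fromBlocks ?_ ?_ ?_ ?_) ?_ ?_ ?_)
  all_goals fun_prop

end SvDet

theorem svDet_eq_of_notMem {z : ℂ} (hz : z ∉ S.eig) (s : ℂ) :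
    S.svDet z 1 (star z) s = (z • S.E - S.A).det * (z • S.E - S.A)ᴴ.det *
      (s • 1 - (S.transfer z)ᴴ * S.transfer z).det := by
  have hX : IsUnit (z • S.E - S.A) := S.notMem_eig_iff.1 hz
  let iX : Invertible (z • S.E - S.A) := hX.invertible
  let iXH : Invertible (z • S.E - S.A)ᴴ := hX.star.invertible
  have hXH : star z • S.Eᴴ - S.Aᴴ = (z • S.E - S.A)ᴴ := by
    rw [Matrix.conjTranspose_sub, Matrix.conjTranspose_smul]
  simp only [svDet, Algebra.algebraMap_self, RingHom.coe_id, Matrix.map_id, one_smul, hXH]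
  let iblock := Matrix.fromBlocksZero₁₂Invertible (z • S.E - S.A) (-(S.Cᴴ * S.C))
    (z • S.E - S.A)ᴴ
  rw [Matrix.det_fromBlocks₁₁, Matrix.det_fromBlocks_zero₁₂, Matrix.invOf_fromBlocks_zero₁₂_eq]
  simp only [Matrix.fromCols_mul_fromBlocks, Matrix.fromCols_mul_fromRows,
    Matrix.invOf_eq_nonsing_inv, transfer, Matrix.conjTranspose_add, Matrix.conjTranspose_mul,
    Matrix.conjTranspose_nonsing_inv]
  congr 2
  simp only [Matrix.mul_add, Matrix.add_mul, Matrix.neg_mul, Matrix.mul_neg, Matrix.mul_assoc,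
    Matrix.mul_zero, Matrix.zero_mul, neg_neg]
  abel

theorem isUnit_R (hD : ‖S.D‖ < γ) : IsUnit (S.R γ) := by
  rw [← IsUnit.neg_iff, R, neg_sub, isUnit_matrix_iff_det_ne_zero]
  exact det_sq_sub_conjTranspose_mul_self_ne_zero S.D hD

theorem isUnit_Sm (hD : ‖S.D‖ < γ) : IsUnit (S.Sm γ) := by
  rw [← IsUnit.neg_iff, Sm, neg_sub, isUnit_matrix_iff_det_ne_zero]
  have h := det_sq_sub_conjTranspose_mul_self_ne_zero S.Dᴴ (γ := γ)
    (by rwa [Matrix.l2_opNorm_conjTranspose])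
  rwa [Matrix.conjTranspose_conjTranspose] at h

theorem conjTranspose_R_inv (γ : ℝ) : ((S.R γ)⁻¹)ᴴ = (S.R γ)⁻¹ := by
  rw [Matrix.conjTranspose_nonsing_inv]
  congr 1
  simp [R, Matrix.conjTranspose_smul]

theorem D_mul_R_inv_mul (hD : ‖S.D‖ < γ) :
    S.D * (S.R γ)⁻¹ * S.Dᴴ - 1 = ((γ ^ 2 : ℝ) : ℂ) • (S.Sm γ)⁻¹ := by
  have hR := (Matrix.isUnit_iff_isUnit_det _).1 (S.isUnit_R hD)
  have hS := (Matrix.isUnit_iff_isUnit_det _).1 (S.isUnit_Sm hD)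
  have hcomm : S.Sm γ * S.D = S.D * S.R γ := by
    simp [Sm, R, Matrix.sub_mul, Matrix.mul_sub, Matrix.mul_assoc]
  have hDR : S.Sm γ * (S.D * (S.R γ)⁻¹) = S.D := by
    rw [← Matrix.mul_assoc, hcomm, Matrix.mul_assoc, Matrix.mul_nonsing_inv _ hR, Matrix.mul_one]
  calc S.D * (S.R γ)⁻¹ * S.Dᴴ - 1
      = (S.Sm γ)⁻¹ * (S.Sm γ * (S.D * (S.R γ)⁻¹ * S.Dᴴ - 1)) := by
        rw [← Matrix.mul_assoc, Matrix.nonsing_inv_mul _ hS, Matrix.one_mul]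
    _ = (S.Sm γ)⁻¹ * (S.D * S.Dᴴ - S.Sm γ) := by
        rw [Matrix.mul_sub, ← Matrix.mul_assoc (S.Sm γ), hDR, Matrix.mul_one]
    _ = ((γ ^ 2 : ℝ) : ℂ) • (S.Sm γ)⁻¹ := by
        rw [Sm, sub_sub_cancel, Matrix.mul_smul, Matrix.mul_one]

theorem svDet_sq_eq_zero_iff (hD : ‖S.D‖ < γ) (z v : ℂ) :
    S.svDet z 1 v ((γ ^ 2 : ℝ) : ℂ) = 0 ↔
      (Matrix.fromBlocks (z • S.E - (S.A - S.B * (S.R γ)⁻¹ * S.Dᴴ * S.C))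
        (S.B * (S.R γ)⁻¹ * S.Bᴴ) ((γ : ℂ) ^ 2 • (S.Cᴴ * (S.Sm γ)⁻¹ * S.C))
        (v • S.Eᴴ - (S.Aᴴ - S.Cᴴ * S.D * (S.R γ)⁻¹ * S.Bᴴ))).det = 0 := by
  have hR : IsUnit (-S.R γ) := (S.isUnit_R hD).neg
  let iR : Invertible (S.R γ) := (S.isUnit_R hD).invertible
  let iNegR : Invertible (-S.R γ) := invertibleNeg _
  have hinv : ⅟(-S.R γ) = -(S.R γ)⁻¹ := by rw [invOf_neg, Matrix.invOf_eq_nonsing_inv]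
  have hSm : (γ : ℂ) ^ 2 • (S.Cᴴ * (S.Sm γ)⁻¹ * S.C) =
      S.Cᴴ * (S.D * (S.R γ)⁻¹ * S.Dᴴ - 1) * S.C := by
    simp [S.D_mul_R_inv_mul hD]
  have hneg : ((γ ^ 2 : ℝ) : ℂ) • 1 - S.Dᴴ * S.D = -S.R γ := by rw [R, neg_sub]
  simp only [svDet, Algebra.algebraMap_self, RingHom.coe_id, Matrix.map_id, one_smul, hneg]
  rw [Matrix.det_fromBlocks₂₂, mul_eq_zero,
    or_iff_right ((isUnit_matrix_iff_det_ne_zero _).1 hR), hinv, Matrix.fromRows_mul,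
    Matrix.fromRows_mul_fromCols, sub_eq_add_neg, Matrix.fromBlocks_neg, Matrix.fromBlocks_add, hSm]
  refine Iff.of_eq (congrArg (fun M : Matrix (Fin n ⊕ Fin n) (Fin n ⊕ Fin n) ℂ => M.det = 0) ?_)
  congr 1 <;>
  simp only [Matrix.neg_mul, Matrix.mul_neg, neg_neg, Matrix.mul_assoc, Matrix.mul_sub,
    Matrix.sub_mul, Matrix.one_mul] <;>
  abel

theorem mem_vertEigs {ε x y : ℝ} (hD : ‖S.D‖ < ε⁻¹) :
    y ∈ S.vertEigs ε x ↔ S.svDet (x + y * Complex.I : ℂ) 1 (star (x + y * Complex.I : ℂ))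
      ((ε⁻¹ ^ 2 : ℝ) : ℂ) = 0 := by
  have hγ : ((ε⁻¹ : ℝ) : ℂ) ≠ 0 := by exact_mod_cast ((norm_nonneg _).trans_lt hD).ne'
  rw [S.svDet_sq_eq_zero_iff hD, ← det_fromBlocks_smul_eq_zero_iff _ _ _ _ hγ one_ne_zero,
    vertEigs, Set.mem_ofPred_eq, pencilSpec, Set.mem_ofPred_eq]
  refine Iff.of_eq (congrArg (fun M : Matrix (Fin n ⊕ Fin n) (Fin n ⊕ Fin n) ℂ => M.det = 0) ?_)
  rw [contN, contM, Matrix.fromBlocks_smul, sub_eq_add_neg, Matrix.fromBlocks_neg,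
    Matrix.fromBlocks_add]
  congr 1
  · rw [add_smul]; abel
  · simp
  · simp
  · simp only [Matrix.conjTranspose_sub, Matrix.conjTranspose_mul, Matrix.conjTranspose_smul,
      Matrix.conjTranspose_conjTranspose, S.conjTranspose_R_inv, Matrix.mul_assoc, one_smul,
      map_add, map_mul, Complex.conj_ofReal, Complex.conj_I, add_smul, mul_neg, neg_smul,
      Complex.star_def]
    abel

theorem mem_circEigs {ε r θ : ℝ} (hD : ‖S.D‖ < ε⁻¹) :
    θ ∈ S.circEigs ε r ↔ S.svDet (polarPt r θ) 1 (star (polarPt r θ))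
      ((ε⁻¹ ^ 2 : ℝ) : ℂ) = 0 := by
  have hγ : ((ε⁻¹ : ℝ) : ℂ) ≠ 0 := by exact_mod_cast ((norm_nonneg _).trans_lt hD).ne'
  rw [S.svDet_sq_eq_zero_iff hD, ← det_fromBlocks_smul_eq_zero_iff _ _ _ _ hγ
    (Complex.exp_ne_zero (θ * Complex.I)), circEigs, Set.mem_ofPred_eq, pencilSpec,
    Set.mem_ofPred_eq]
  refine Iff.of_eq (congrArg (fun M : Matrix (Fin n ⊕ Fin n) (Fin n ⊕ Fin n) ℂ => M.det = 0) ?_)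
  rw [discT, discS, Matrix.fromBlocks_smul, sub_eq_add_neg, Matrix.fromBlocks_neg,
    Matrix.fromBlocks_add]
  congr 1
  · rw [smul_smul, mul_comm, ← polarPt, ← sub_eq_add_neg]
  · simp
  · simp [smul_smul]
  · rw [smul_sub (Complex.exp _) (_ • _), smul_smul, exp_mul_I_mul_star_polarPt, neg_sub,
      ← sub_eq_add_neg]

section DefiningPolynomial

open Polynomial hiding C

/-- The polynomial in `x`, `s`, `w` whose zeros at `s = σ ^ 2`, `w = i y` contain the points of
the level curve `‖G‖ = σ`, with `z = x + i y`; here `conj z = x - w`. -/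
noncomputable def vertPoly : ℂ[X][X][X] :=
  S.svDet (.C (.C X) + X) 1 (.C (.C X) - X) (.C X)

/-- The polynomial in `r`, `s`, `w` whose zeros at `s = σ ^ 2`, `w = exp (i θ)` contain the points
of the level curve `‖G‖ = σ`, with `z = r w`; here `w * conj z = r`. -/
noncomputable def circPoly : ℂ[X][X][X] := S.svDet (.C (.C X) * X) X (.C (.C X)) (.C X)

theorem evalHom₃_vertPoly (x y : ℝ) (s : ℂ) :
    evalHom₃ x s (y * Complex.I) S.vertPoly =
      S.svDet (x + y * Complex.I : ℂ) 1 (star (x + y * Complex.I : ℂ)) s := by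
  refine (S.map_svDet (R := ℂ[X][X][X]) (T := ℂ) (evalHom₃ x s (y * Complex.I))
    (fun a => by simp [evalHom₃]) _ _ _ _).trans ?_
  simp [evalHom₃, sub_eq_add_neg]

theorem evalHom₃_circPoly (r θ : ℝ) (s : ℂ) :
    evalHom₃ r s (Complex.exp (θ * Complex.I)) S.circPoly =
      Complex.exp (θ * Complex.I) ^ n * S.svDet (polarPt r θ) 1 (star (polarPt r θ)) s := by
  rw [← svDet_mul, exp_mul_I_mul_star_polarPt]
  refine (S.map_svDet (R := ℂ[X][X][X]) (T := ℂ) (evalHom₃ r s (Complex.exp (θ * Complex.I)))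
    (fun a => by simp [evalHom₃]) _ _ _ _).trans ?_
  simp [evalHom₃, polarPt]

end DefiningPolynomial

theorem vertEigs_eq_levelZeros {ε : ℝ} (hD : ‖S.D‖ < ε⁻¹) (x : ℝ) :
    S.vertEigs ε x = levelZeros S.vertPoly (fun y => y * Complex.I) ε⁻¹ x := by
  ext y
  rw [S.mem_vertEigs hD, ← S.evalHom₃_vertPoly]
  rfl

theorem circEigs_eq_levelZeros {ε : ℝ} (hD : ‖S.D‖ < ε⁻¹) (r : ℝ) :
    S.circEigs ε r = levelZeros S.circPoly (fun θ => Complex.exp (θ * Complex.I)) ε⁻¹ r := by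
  ext θ
  rw [S.mem_circEigs hD, levelZeros, Set.mem_ofPred_eq, S.evalHom₃_circPoly,
    mul_eq_zero, or_iff_right (pow_ne_zero _ (Complex.exp_ne_zero _))]

theorem svDet_eq_zero_of_ntf_eq (hE : IsUnit S.E) {z : ℂ} {σ : ℝ} (hσ : 0 < σ)
    (h : S.ntf z = σ) : S.svDet z 1 (star z) ((σ ^ 2 : ℝ) : ℂ) = 0 := by
  obtain htop | ⟨G, hG, hnorm⟩ := S.ntf_eq_top_or_exists_tendsto_transfer z
  · rw [h] at htop; simp at htop
  have hσG : ‖G‖ = σ := by exact_mod_cast hnorm.symm.trans h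
  have hsq : Tendsto (fun w => ((‖S.transfer w‖ ^ 2 : ℝ) : ℂ)) (𝓝[≠] z)
      (𝓝 ((σ ^ 2 : ℝ) : ℂ)) := by
    rw [← hσG]
    exact (Complex.continuous_ofReal.tendsto _).comp (hG.norm.pow 2)
  have hlim : Tendsto (fun w => S.svDet w 1 (star w) ((‖S.transfer w‖ ^ 2 : ℝ) : ℂ)) (𝓝[≠] z)
      (𝓝 (S.svDet z 1 (star z) ((σ ^ 2 : ℝ) : ℂ))) := by
    have hid : Tendsto (fun w : ℂ => w) (𝓝[≠] z) (𝓝 z) := nhdsWithin_le_nhds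
    refine (S.continuous_svDet.tendsto (z, star z, ((σ ^ 2 : ℝ) : ℂ))).comp
      (f := fun w : ℂ => (w, star w, ((‖S.transfer w‖ ^ 2 : ℝ) : ℂ))) ?_
    exact hid.prodMk_nhds (((continuous_star.tendsto z).comp hid).prodMk_nhds hsq)
  refine tendsto_nhds_unique hlim (Tendsto.congr' ?_ tendsto_const_nhds)
  have hpos : ∀ᶠ w in 𝓝[≠] z, 0 < ‖S.transfer w‖ :=
    hG.norm.eventually (lt_mem_nhds (by rwa [hσG]))
  filter_upwards [hpos, S.eventually_notMem_eig hE z] with w hw hwE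
  rw [S.svDet_eq_of_notMem hwE, det_norm_sq_sub_conjTranspose_mul_self _ hw, mul_zero]

theorem svDet_ne_zero {z : ℂ} (hz : z ∉ S.eig) (h : S.ntf z < γ) :
    S.svDet z 1 (star z) ((γ ^ 2 : ℝ) : ℂ) ≠ 0 := by
  have hdet : (z • S.E - S.A).det ≠ 0 := hz
  rw [S.ntf_of_notMem hz, EReal.coe_lt_coe_iff] at h
  rw [S.svDet_eq_of_notMem hz, Matrix.det_conjTranspose]
  exact mul_ne_zero (mul_ne_zero hdet (star_ne_zero.2 hdet))
    (det_sq_sub_conjTranspose_mul_self_ne_zero _ h)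

end LTISystem
theorem disjoint_frontier_connectedComponentIn {X : Type*} [TopologicalSpace X]
    [LocallyConnectedSpace X] {W : Set X} (hW : IsOpen W) (x : X) :
    Disjoint (frontier (connectedComponentIn W x)) W := by
  refine Set.disjoint_left.2 fun w hw hwW => ?_
  rw [hW.connectedComponentIn.frontier_eq] at hw
  obtain ⟨v, hvw, hvx⟩ := mem_closure_iff.1 hw.1 _ hW.connectedComponentIn
    (mem_connectedComponentIn hwW)
  refine hw.2 ?_
  rw [connectedComponentIn_eq hvx, ← connectedComponentIn_eq hvw]
  exact mem_connectedComponentIn hwW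

namespace LTISystem

variable {n m p : ℕ} (S : LTISystem n m p) {z : ℂ} {γ ε : ℝ}

section SpectralValueSet

theorem det_sub_pert_mul (hz : z ∉ S.eig) {Δ : Matrix (Fin m) (Fin p) ℂ}
    (hΔ : IsUnit (1 - S.D * Δ)) :
    (z • S.E - S.pert Δ).det * (1 - S.D * Δ).det =
      (z • S.E - S.A).det * (1 - S.transfer z * Δ).det := by
  have hX := (Matrix.isUnit_iff_isUnit_det _).1 (S.notMem_eig_iff.1 hz)
  have hW := (Matrix.isUnit_iff_isUnit_det _).1 hΔ
  set X := z • S.E - S.A with hXdef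
  set W := 1 - S.D * Δ with hWdef
  have hpert : z • S.E - S.pert Δ = X * (1 - X⁻¹ * S.B * (Δ * W⁻¹ * S.C)) := by
    rw [Matrix.mul_sub, Matrix.mul_one, ← Matrix.mul_assoc, ← Matrix.mul_assoc X,
      Matrix.mul_nonsing_inv _ hX, Matrix.one_mul, pert, hXdef, ← hWdef, sub_add_eq_sub_sub]
    simp only [Matrix.mul_assoc]
  have hcomm : (1 - X⁻¹ * S.B * (Δ * W⁻¹ * S.C)).det =
      (1 - S.C * (X⁻¹ * S.B) * (Δ * W⁻¹)).det := by
    rw [Matrix.det_one_sub_mul_comm, Matrix.mul_assoc (Δ * W⁻¹), Matrix.det_one_sub_mul_comm]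
  have htransfer : (1 - S.C * (X⁻¹ * S.B) * (Δ * W⁻¹)) * W = 1 - S.transfer z * Δ := by
    rw [Matrix.sub_mul, Matrix.one_mul, Matrix.mul_assoc, Matrix.mul_assoc Δ,
      Matrix.nonsing_inv_mul _ hW, Matrix.mul_one, hWdef, transfer, Matrix.add_mul,
      sub_sub, add_comm (S.D * Δ), ← hXdef]
    simp only [Matrix.mul_assoc]
  rw [hpert, Matrix.det_mul, hcomm, mul_assoc, ← Matrix.det_mul, htransfer]

theorem mem_pencilSpec_pert_iff (hz : z ∉ S.eig) {Δ : Matrix (Fin m) (Fin p) ℂ}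
    (hΔ : IsUnit (1 - S.D * Δ)) :
    z ∈ pencilSpec (S.pert Δ) S.E ↔ (1 - S.transfer z * Δ).det = 0 := by
  have hX : (z • S.E - S.A).det ≠ 0 := hz
  have hW := (isUnit_matrix_iff_det_ne_zero _).1 hΔ
  rw [pencilSpec, Set.mem_ofPred_eq, ← mul_left_inj' hW, zero_mul, S.det_sub_pert_mul hz hΔ,
    mul_eq_zero, or_iff_right hX]

theorem mem_svs_iff_of_notMem (hD : ‖S.D‖ < ε⁻¹) (hz : z ∉ S.eig) :
    z ∈ S.svs ε ↔ ε⁻¹ ≤ ‖S.transfer z‖ := by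
  have hε : 0 < ε := inv_pos.1 ((norm_nonneg _).trans_lt hD)
  constructor
  · rintro ⟨Δ, hΔ, hzΔ⟩
    by_contra! hlt
    exact (isUnit_matrix_iff_det_ne_zero _).1 (isUnit_one_sub_mul_of_norm_lt_inv hlt hΔ)
      ((S.mem_pencilSpec_pert_iff hz (isUnit_one_sub_mul_of_norm_lt_inv hD hΔ)).1 hzΔ)
  · intro hle
    obtain ⟨Δ, hΔ, hdet⟩ := exists_norm_eq_inv_det_one_sub_mul_eq_zero (S.transfer z)
      ((inv_pos.2 hε).trans_le hle)
    have hΔε : ‖Δ‖ ≤ ε := hΔ.trans_le (inv_le_of_inv_le₀ hε hle)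
    exact ⟨Δ, hΔε, (S.mem_pencilSpec_pert_iff hz
      (isUnit_one_sub_mul_of_norm_lt_inv hD hΔε)).2 hdet⟩

theorem eig_subset_svs (hε : 0 ≤ ε) : S.eig ⊆ S.svs ε := fun z hz =>
  ⟨0, by simpa using hε, by simpa [pert, eig] using hz⟩

theorem svs_eq (hD : ‖S.D‖ < ε⁻¹) :
    S.svs ε = S.eig ∪ S.ntf ⁻¹' Set.Ici ((ε⁻¹ : ℝ) : EReal) := by
  ext z
  by_cases hz : z ∈ S.eig
  · simp [hz, S.eig_subset_svs (inv_pos.1 ((norm_nonneg _).trans_lt hD)).le hz]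
  · rw [S.mem_svs_iff_of_notMem hD hz, ← EReal.coe_le_coe_iff, ← S.ntf_of_notMem hz]
    simp [hz]

theorem mem_svs_of_le_ntf (hD : ‖S.D‖ < ε⁻¹) (hz : ((ε⁻¹ : ℝ) : EReal) ≤ S.ntf z) :
    z ∈ S.svs ε := by
  rw [S.svs_eq hD]
  exact .inr hz

theorem isCompact_svs (hE : IsUnit S.E) (hD : ‖S.D‖ < ε⁻¹) : IsCompact (S.svs ε) := by
  obtain ⟨M, hM⟩ := S.exists_forall_ntf_lt hE hD
  rw [S.svs_eq hD]
  refine (S.finite_eig hE).isCompact.union (Metric.isCompact_of_isClosed_isBounded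
    (isClosed_Ici.preimage (S.continuous_ntf hE)) ?_)
  refine (Metric.isBounded_ball (x := (0 : ℂ)) (r := M)).subset fun z hz => ?_
  rw [mem_ball_zero_iff]
  exact not_le.1 fun hMz => (hM z hMz).2.not_ge hz

theorem isGreatest_sSup_image_svs (hn : 0 < n) (hE : IsUnit S.E) (hD : ‖S.D‖ < ε⁻¹) {f : ℂ → ℝ}
    (hf : Continuous f) : IsGreatest (f '' S.svs ε) (sSup (f '' S.svs ε)) :=
  ((S.isCompact_svs hE hD).image hf).isGreatest_sSup (((S.nonempty_eig hn hE).mono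
    (S.eig_subset_svs (inv_pos.1 ((norm_nonneg _).trans_lt hD)).le)).image f)

theorem le_ntf_of_not_isIsolatedPoint (hE : IsUnit S.E) (hD : ‖S.D‖ < ε⁻¹) (hz : z ∈ S.svs ε)
    (hiso : ¬ IsIsolatedPoint (S.svs ε) z) : ((ε⁻¹ : ℝ) : EReal) ≤ S.ntf z := by
  by_contra! hlt
  have hnear : ∀ᶠ w in 𝓝 z, w ∈ S.svs ε → w = z := by
    filter_upwards [(S.continuous_ntf hE).continuousAt.eventually_lt_const hlt,
      eventually_nhdsWithin_iff.1 (S.eventually_notMem_eig hE z)] with w hw hwE hwε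
    by_contra hwz
    rw [S.svs_eq hD] at hwε
    exact hwε.elim (hwE hwz) hw.not_ge
  refine hiso ⟨_, hnear, Set.Subset.antisymm (fun w hw => hw.2 hw.1) ?_⟩
  rintro _ rfl
  exact ⟨hz, fun _ => rfl⟩

end SpectralValueSet

section SearchCurves

theorem hasAlgebraicLevels_vert (hE : IsUnit S.E) :
    HasAlgebraicLevels (fun x y => S.ntf (x + y * Complex.I)) (fun y => y * Complex.I)
      S.vertPoly where
  continuous_uncurry := (S.continuous_ntf hE).comp
    (f := fun q : ℝ × ℝ => ((q.1 : ℂ) + q.2 * Complex.I)) (by fun_prop)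
  contDiff := Complex.ofRealCLM.contDiff.mul contDiff_const
  deriv_ne_zero y := by
    have hderiv := (Complex.ofRealCLM.hasDerivAt (x := y)).mul_const Complex.I
    simp only [Complex.ofRealCLM_apply] at hderiv
    simp [hderiv.deriv]
  eval_eq_zero x y σ hσ h := by
    rw [S.evalHom₃_vertPoly]
    exact S.svDet_eq_zero_of_ntf_eq hE hσ h

theorem hasAlgebraicLevels_circ (hE : IsUnit S.E) :
    HasAlgebraicLevels (fun r θ => S.ntf (polarPt r θ)) (fun θ => Complex.exp (θ * Complex.I))
      S.circPoly where
  continuous_uncurry := (S.continuous_ntf hE).comp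
    (f := fun q : ℝ × ℝ => polarPt q.1 q.2) (by unfold polarPt; fun_prop)
  contDiff := (Complex.ofRealCLM.contDiff.mul contDiff_const).cexp
  deriv_ne_zero y := by
    have hderiv := ((Complex.ofRealCLM.hasDerivAt (x := y)).mul_const Complex.I).cexp
    simp only [Complex.ofRealCLM_apply] at hderiv
    simp [hderiv.deriv]
  eval_eq_zero x y σ hσ h := by
    rw [S.evalHom₃_circPoly, S.svDet_eq_zero_of_ntf_eq hE hσ h, mul_zero]

theorem exists_forall_notMem_levelZeros_vertPoly (hE : IsUnit S.E) (hD : ‖S.D‖ < γ) :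
    ∃ M : ℝ, ∀ x y : ℝ, M ≤ |y| →
      y ∉ levelZeros S.vertPoly (fun y => y * Complex.I) γ x ∧
        S.ntf (x + y * Complex.I) < γ := by
  obtain ⟨M, hM⟩ := S.exists_forall_ntf_lt hE hD
  refine ⟨M, fun x y hy => ?_⟩
  obtain ⟨hzE, hlt⟩ := hM (x + y * Complex.I)
    (hy.trans (by simpa using Complex.abs_im_le_norm (x + y * Complex.I)))
  refine ⟨fun hmem => S.svDet_ne_zero hzE hlt ?_, hlt⟩
  rwa [← S.evalHom₃_vertPoly]

end SearchCurves

section MaximumPrinciple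

theorem eventually_ntf_eq_of_isLocalMax (hE : IsUnit S.E) (hz : z ∉ S.poles)
    (hmax : IsLocalMax S.ntf z) : ∀ᶠ w in 𝓝 z, S.ntf w = S.ntf z := by
  have hreg : ∀ᶠ w in 𝓝 z, w ∉ S.poles := hmax.mono fun w hw htop =>
    hz (top_le_iff.1 (le_of_eq_of_le (Eq.symm htop) hw))
  have hnorm : IsLocalMax (norm ∘ S.transferExt) z := by
    filter_upwards [hmax, hreg] with w hw hwp
    rwa [S.ntf_eq_norm_transferExt hwp, S.ntf_eq_norm_transferExt hz, EReal.coe_le_coe_iff] at hw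
  filter_upwards [hreg, Complex.norm_eventually_eq_of_isLocalMax
    (hreg.mono fun w hw => S.differentiableAt_transferExt hE hw) hnorm] with w hwp hw
  rw [S.ntf_eq_norm_transferExt hwp, hw, S.ntf_eq_norm_transferExt hz]

theorem not_isLocalMax_ntf (hE : IsUnit S.E) (hD : ‖S.D‖ < γ) (hz : S.ntf z = γ) :
    ¬ IsLocalMax S.ntf z := fun hmax => by
  have hpole : z ∉ S.poles := fun htop => EReal.coe_ne_top γ (hz.symm.trans htop)
  have hP := S.hasAlgebraicLevels_vert hE
  obtain ⟨M, hM⟩ := S.exists_forall_notMem_levelZeros_vertPoly hE hD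
  have hline : Tendsto (fun y : ℝ => (z.re + y * Complex.I : ℂ)) (𝓝 z.im) (𝓝 z) := by
    have hcont : Continuous fun y : ℝ => (z.re + y * Complex.I : ℂ) := by fun_prop
    simpa only [Complex.re_add_im] using hcont.tendsto z.im
  have hdense := hP.dense_compl_levelZeros (hM z.re M (le_abs_self M)).1
  obtain ⟨y, hy, hyzero⟩ := hdense.inter_nhds_nonempty
    (hline.eventually (S.eventually_ntf_eq_of_isLocalMax hE hpole hmax))
  exact hy (hP.eval_eq_zero z.re y γ ((norm_nonneg _).trans_lt hD) (hyzero.trans hz))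

/-- The open set on which the norm of the transfer function exceeds `γ`; for `γ = ε⁻¹`, up to
isolated points, the spectral value set is its closure. -/
def superlevel (γ : ℝ) : Set ℂ := {z | (γ : EReal) < S.ntf z}

theorem isOpen_superlevel (hE : IsUnit S.E) (γ : ℝ) : IsOpen (S.superlevel γ) :=
  isOpen_Ioi.preimage (S.continuous_ntf hE)

theorem mem_closure_superlevel (hE : IsUnit S.E) (hD : ‖S.D‖ < γ) (hz : γ ≤ S.ntf z) :
    z ∈ closure (S.superlevel γ) := by
  by_contra hcl
  have hle : ∀ᶠ w in 𝓝 z, S.ntf w ≤ γ := by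
    filter_upwards [isClosed_closure.isOpen_compl.mem_nhds hcl] with w hw
    exact not_lt.1 fun h => hw (subset_closure h)
  have heq : S.ntf z = γ := hle.self_of_nhds.antisymm hz
  exact S.not_isLocalMax_ntf hE hD heq (hle.mono fun w hw => hw.trans_eq heq.symm)

theorem exists_mem_poles_connectedComponentIn (hE : IsUnit S.E) (hD : ‖S.D‖ < γ)
    (hz : z ∈ S.superlevel γ) :
    ∃ w ∈ S.poles, w ∈ connectedComponentIn (S.superlevel γ) z := by
  by_contra! hno
  set V := connectedComponentIn (S.superlevel γ) z with hV
  have hfrontier : ∀ w ∈ frontier V, S.ntf w ≤ γ := fun w hw => not_lt.1 fun hlt =>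
    (disjoint_frontier_connectedComponentIn (S.isOpen_superlevel hE γ) z).le_bot ⟨hw, hlt⟩
  have hreg : ∀ w ∈ closure V, w ∉ S.poles := fun w hw htop => by
    rw [closure_eq_self_union_frontier] at hw
    rcases hw with hw | hw
    · exact hno w htop hw
    · exact (EReal.coe_lt_top γ).not_ge (le_of_eq_of_le (Eq.symm htop) (hfrontier w hw))
  have hbdd : Bornology.IsBounded V := by
    obtain ⟨M, hM⟩ := S.exists_forall_ntf_lt hE hD
    refine (Metric.isBounded_ball (x := (0 : ℂ)) (r := M)).subset fun w hw => ?_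
    rw [mem_ball_zero_iff]
    exact not_le.1 fun hMw => (hM w hMw).2.not_gt
      (show w ∈ S.superlevel γ from connectedComponentIn_subset _ _ hw)
  have hzV : z ∈ closure V := subset_closure (mem_connectedComponentIn hz)
  have hle : ‖S.transferExt z‖ ≤ γ := by
    refine Complex.norm_le_of_forall_mem_frontier_norm_le hbdd (DifferentiableOn.diffContOnCl
      fun w hw => (S.differentiableAt_transferExt hE (hreg w hw)).differentiableWithinAt)
      (fun w hw => ?_) hzV
    rw [← EReal.coe_le_coe_iff, ← S.ntf_eq_norm_transferExt (hreg w (frontier_subset_closure hw))]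
    exact hfrontier w hw
  rw [superlevel, Set.mem_ofPred_eq, S.ntf_eq_norm_transferExt (hreg z hzV),
    EReal.coe_lt_coe_iff] at hz
  exact hz.not_ge hle

theorem exists_mem_superlevel_eq (hE : IsUnit S.E) (hD : ‖S.D‖ < γ) {f : ℂ → ℝ}
    (hf : Continuous f) {t : ℝ} (ht : ∀ w ∈ S.poles, f w ≤ t) (hz : γ ≤ S.ntf z) (htz : t < f z) :
    ∃ w ∈ S.superlevel γ, f w = t := by
  obtain ⟨v, htv, hv⟩ := mem_closure_iff.1 (S.mem_closure_superlevel hE hD hz) _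
    (isOpen_Ioi.preimage hf) htz
  obtain ⟨w, hwp, hw⟩ := S.exists_mem_poles_connectedComponentIn hE hD hv
  obtain ⟨u, hu, hfu⟩ := isPreconnected_connectedComponentIn.intermediate_value hw
    (mem_connectedComponentIn hv) hf.continuousOn ⟨ht w hwp, (Set.mem_preimage.1 htv).le⟩
  exact ⟨u, connectedComponentIn_subset _ _ hu, hfu⟩

end MaximumPrinciple

section Selection

variable {Λ : Set ℂ} {f : ℂ → ℝ}

variable {S} in
theorem IsSelection.poles_subset (hΛ : S.IsSelection Λ) : S.poles ⊆ Λ := fun z hz => by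
  by_contra hzΛ
  exact (hΛ.2 z (S.poles_subset_eig hz) hzΛ).2 hz

/-- The condition on the selection `Λ` under which no isolated point of the spectral value set left
out of it decides the maximum of `f`; `f` is the real part for the abscissa and the modulus for the
radius. -/
def DominatesOmitted (ε : ℝ) (Λ : Set ℂ) (f : ℂ → ℝ) : Prop :=
  ∀ z ∈ S.eig, z ∉ Λ → IsIsolatedPoint (S.svs ε) z →
    ∃ w ∈ S.svs ε, (w ∈ Λ ∨ ¬ IsIsolatedPoint (S.svs ε) w) ∧ f z ≤ f w

namespace DominatesOmitted

variable {S} {L t : ℝ}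

theorem exists_eq_of_isGreatest (hdom : S.DominatesOmitted ε Λ f) (hE : IsUnit S.E)
    (hD : ‖S.D‖ < ε⁻¹) (hL : IsGreatest (f '' S.svs ε) L) :
    ∃ w, f w = L ∧ (w ∈ Λ ∨ ((ε⁻¹ : ℝ) : EReal) ≤ S.ntf w) := by
  obtain ⟨⟨w, hw, rfl⟩, hmax⟩ := hL
  by_cases hwε : w ∈ Λ ∨ ((ε⁻¹ : ℝ) : EReal) ≤ S.ntf w
  · exact ⟨w, rfl, hwε⟩
  obtain ⟨hwΛ, hlt⟩ := not_or.1 hwε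
  have hwE : w ∈ S.eig := by
    rw [S.svs_eq hD] at hw
    exact hw.resolve_right hlt
  have hiso : IsIsolatedPoint (S.svs ε) w :=
    not_not.1 fun hiso => hlt (S.le_ntf_of_not_isIsolatedPoint hE hD hw hiso)
  obtain ⟨v, hv, hvΛ, hle⟩ := hdom w hwE hwΛ hiso
  exact ⟨v, (hmax ⟨v, hv, rfl⟩).antisymm hle,
    hvΛ.imp_right (S.le_ntf_of_not_isIsolatedPoint hE hD hv)⟩

theorem exists_mem_superlevel_eq (hdom : S.DominatesOmitted ε Λ f) (hE : IsUnit S.E)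
    (hD : ‖S.D‖ < ε⁻¹) (hΛ : S.poles ⊆ Λ) (hf : Continuous f) (hL : IsGreatest (f '' S.svs ε) L)
    (ht : ∀ w ∈ Λ, f w ≤ t) (htL : t < L) : ∃ z ∈ S.superlevel ε⁻¹, f z = t := by
  obtain ⟨w, rfl, hw | hw⟩ := hdom.exists_eq_of_isGreatest hE hD hL
  · exact absurd (ht w hw) htL.not_ge
  · exact S.exists_mem_superlevel_eq hE hD hf (fun z hz => ht z (hΛ hz)) hw htL

theorem nonempty (hdom : S.DominatesOmitted ε Λ f) (hE : IsUnit S.E) (hD : ‖S.D‖ < ε⁻¹)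
    (hΛ : S.poles ⊆ Λ) (hL : IsGreatest (f '' S.svs ε) L) : Λ.Nonempty := by
  obtain ⟨w, -, hw | hw⟩ := hdom.exists_eq_of_isGreatest hE hD hL
  · exact ⟨w, hw⟩
  · obtain ⟨v, hv⟩ := closure_nonempty_iff.1 ⟨w, S.mem_closure_superlevel hE hD hw⟩
    obtain ⟨u, hu, -⟩ := S.exists_mem_poles_connectedComponentIn hE hD hv
    exact ⟨u, hΛ hu⟩

theorem tendsto (hdom : S.DominatesOmitted ε Λ f) (hE : IsUnit S.E) (hD : ‖S.D‖ < ε⁻¹)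
    (hΛ : S.poles ⊆ Λ) (hf : Continuous f) (hL : IsGreatest (f '' S.svs ε) L)
    {F : ℝ → ℝ → EReal} {Θ : ℕ → Set ℝ} {η : ℕ → ℝ} (hΛη : ∀ w ∈ Λ, f w ≤ η 0) (hη₀ : η 0 ≤ L)
    (hstep : ∀ k, SearchStep F L (Θ k) (η k) (η (k + 1))) (hroot : ∀ ψ r, F ψ r = 0 → r ≤ L)
    (hstall : (∀ k, FastSearchSet F (η k) (Θ k) (η (k + 1))) →
      ∀ z ∈ S.superlevel ε⁻¹, ¬ Tendsto η atTop (𝓝 (f z))) :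
    Tendsto η atTop (𝓝 L) := by
  refine SearchStep.tendsto hstep hroot hη₀ fun η' hη' => not_lt.1 fun hlt => ?_
  have hle : ∀ k, η k ≤ η' := (SearchStep.monotone hstep).ge_of_tendsto hη'
  obtain ⟨z, hz, rfl⟩ := hdom.exists_mem_superlevel_eq hE hD hΛ hf hL
    (fun w hw => (hΛη w hw).trans (hle 0)) hlt
  exact hstall (fun k => (hstep k).1 ((hle k).trans_lt hlt)) z hz hη'

end DominatesOmitted

end Selection

end LTISystem

namespace LTISystem

variable {n m p : ℕ} (S : LTISystem n m p) {z : ℂ} {ε : ℝ} {Λ : Set ℂ} {η : ℕ → ℝ}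

section Abscissa

theorem horizFun_pos_iff {x y : ℝ} :
    0 < S.horizFun ε y x ↔ (x + y * Complex.I : ℂ) ∈ S.superlevel ε⁻¹ :=
  EReal.sub_pos

theorem exists_root_horizFun (hE : IsUnit S.E) (hD : ‖S.D‖ < ε⁻¹) (ψ x : ℝ)
    (h : 0 < S.horizFun ε ψ x) : ∃ r, IsRootToTheRight (S.horizFun ε ψ) x r := by
  obtain ⟨M, hM⟩ := S.exists_forall_ntf_lt hE hD
  refine exists_isRootToTheRight ((S.hasAlgebraicLevels_vert hE).continuous_left ψ)
    (S.horizFun_pos_iff.1 h) fun x (hx : M ≤ x) => (hM _ ?_).2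
  calc M ≤ |x| := hx.trans (le_abs_self x)
    _ ≤ ‖(x + ψ * Complex.I : ℂ)‖ := by
      simpa using Complex.abs_re_le_norm (x + ψ * Complex.I)

theorem isGreatest_abscissa (hn : 0 < n) (hE : IsUnit S.E) (hD : ‖S.D‖ < ε⁻¹) :
    IsGreatest (Complex.re '' S.svs ε) (S.abscissa ε) :=
  S.isGreatest_sSup_image_svs hn hE hD Complex.continuous_re

theorem le_abscissa_of_horizFun_eq_zero (hn : 0 < n) (hE : IsUnit S.E) (hD : ‖S.D‖ < ε⁻¹)
    (ψ r : ℝ) (h : S.horizFun ε ψ r = 0) : r ≤ S.abscissa ε :=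
  (S.isGreatest_abscissa hn hE hD).2
    ⟨r + ψ * Complex.I, S.mem_svs_of_le_ntf hD (ereal_sub_coe_eq_zero_iff.1 h).ge, by simp⟩

theorem finite_vertEigs (hE : IsUnit S.E) (hD : ‖S.D‖ < ε⁻¹) (x : ℝ) :
    (S.vertEigs ε x).Finite := by
  obtain ⟨M, hM⟩ := S.exists_forall_notMem_levelZeros_vertPoly hE hD
  rw [S.vertEigs_eq_levelZeros hD, levelZeros_eq_preimage]
  refine (finite_isRoot_of_notMem_levelZeros (hM x M (le_abs_self M)).1).preimage ?_
  exact fun y _ y' _ h => Complex.ofReal_injective (mul_right_cancel₀ Complex.I_ne_zero h)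

theorem finite_vertMidpoints (hE : IsUnit S.E) (hD : ‖S.D‖ < ε⁻¹) (x : ℝ) :
    (S.vertMidpoints ε x).Finite := by
  simpa [vertMidpoints] using
    finite_setOf_crossSection_midpoint (s := Set.univ) ((S.finite_vertEigs hE hD x).inter_of_left _)
      fun y => (x + y * Complex.I : ℂ) ∈ S.svs ε

theorem exists_forall_nonempty_vertEigs_inter_Icc (hE : IsUnit S.E) (hD : ‖S.D‖ < ε⁻¹) :
    ∃ M : ℝ, ∀ x y : ℝ, (x + y * Complex.I : ℂ) ∈ S.superlevel ε⁻¹ →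
      (S.vertEigs ε x ∩ Set.Icc (-M) y).Nonempty ∧ (S.vertEigs ε x ∩ Set.Icc y M).Nonempty := by
  obtain ⟨M, hM⟩ := S.exists_forall_notMem_levelZeros_vertPoly hE hD
  refine ⟨M, fun x y hy => ?_⟩
  have hP := S.hasAlgebraicLevels_vert hE
  have hcont := hP.continuous_right x
  have hyM : |y| < M := not_le.1 fun h => (hM x y h).2.not_gt hy
  obtain ⟨hMy, hyM⟩ := abs_lt.1 hyM
  obtain ⟨c, hc, hcγ⟩ := intermediate_value_Icc hMy.le hcont.continuousOn
    ⟨(hM x (-M) (by rw [abs_neg]; exact le_abs_self M)).2.le, hy.le⟩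
  obtain ⟨d, hd, hdγ⟩ := intermediate_value_Icc' hyM.le hcont.continuousOn
    ⟨(hM x M (le_abs_self M)).2.le, hy.le⟩
  have hγ : 0 < ε⁻¹ := (norm_nonneg _).trans_lt hD
  rw [S.vertEigs_eq_levelZeros hD]
  exact ⟨⟨c, hP.eval_eq_zero x c _ hγ hcγ, hc⟩, ⟨d, hP.eval_eq_zero x d _ hγ hdγ, hd⟩⟩

theorem not_tendsto_re_of_mem_superlevel (hE : IsUnit S.E) (hD : ‖S.D‖ < ε⁻¹)
    (hη : ∀ k, FastSearchSet (S.horizFun ε) (η k) (S.vertMidpoints ε (η k)) (η (k + 1)))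
    (hz : z ∈ S.superlevel ε⁻¹) : ¬ Tendsto η atTop (𝓝 z.re) := fun hlim => by
  have hP := S.hasAlgebraicLevels_vert hE
  obtain ⟨M, hM⟩ := S.exists_forall_nonempty_vertEigs_inter_Icc hE hD
  obtain ⟨N, hN⟩ := S.exists_forall_notMem_levelZeros_vertPoly hE hD
  rw [← Complex.re_add_im z] at hz
  obtain ⟨δ, hδ, hbox⟩ := hP.exists_forall_mem_Icc_lt hz
  have hnear : ∀ y ∈ Set.Icc (z.im - δ) (z.im + δ),
      ∀ᶠ k in atTop, (η k + y * Complex.I : ℂ) ∈ S.superlevel ε⁻¹ := fun y hy =>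
    hlim.eventually ((hP.continuous_left y).continuousAt.eventually_const_lt (hbox y hy))
  have hcross := hP.eventually_exists_isCrossSection_of_monotone ((norm_nonneg _).trans_lt hD)
    (monotone_nat_of_le_succ fun k => (hη k).le) hlim hδ hbox (-M) M
  simp only [← S.vertEigs_eq_levelZeros hD] at hcross hN
  obtain ⟨k, hk, hleft, hright⟩ := (hcross.and ((hnear (z.im - δ) ⟨le_rfl, by linarith⟩).and
    (hnear (z.im + δ) ⟨by linarith, le_rfl⟩))).exists
  obtain ⟨c, d, hcd, hgt⟩ := hk ⟨N, (hN (η k) N (le_abs_self N)).1⟩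
    (hM _ _ hleft).1 (hM _ _ hright).2
  obtain ⟨t, ht, hnotpos⟩ := (hη k).exists_not_pos
    ⟨c, d, hcd.mono fun y => S.mem_svs_of_le_ntf hD, rfl⟩
  exact hnotpos (S.horizFun_pos_iff.2 (hgt t ht))

variable {S} in
theorem IsAbsRun.tendsto (hn : 0 < n) (hE : IsUnit S.E) (hD : ‖S.D‖ < ε⁻¹)
    (hΛ : S.IsSelection Λ) (hdom : S.DominatesOmitted ε Λ Complex.re) (hη : S.IsAbsRun ε Λ η) :
    Tendsto η atTop (𝓝 (S.abscissa ε)) := by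
  obtain ⟨⟨z₀, hz₀, hmax, hinit⟩, hstep⟩ := hη
  have hL := S.isGreatest_abscissa hn hE hD
  have hroot := S.le_abscissa_of_horizFun_eq_zero hn hE hD
  have hε : 0 ≤ ε := (inv_pos.1 ((norm_nonneg _).trans_lt hD)).le
  exact hdom.tendsto hE hD hΛ.poles_subset Complex.continuous_re hL
    (fun w hw => (hmax w hw).trans hinit.le)
    (hinit.le_of_forall_root_le hroot (hL.2 ⟨z₀, S.eig_subset_svs hε (hΛ.1 hz₀), rfl⟩))
    hstep hroot fun hfast z hz => S.not_tendsto_re_of_mem_superlevel hE hD hfast hz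

theorem exists_absInit (hn : 0 < n) (hE : IsUnit S.E) (hD : ‖S.D‖ < ε⁻¹)
    (hΛ : S.IsSelection Λ) (hdom : S.DominatesOmitted ε Λ Complex.re) : ∃ x, S.AbsInit ε Λ x := by
  obtain ⟨z₀, hz₀, hmax⟩ := Set.exists_max_image Λ Complex.re ((S.finite_eig hE).subset hΛ.1)
    (hdom.nonempty hE hD hΛ.poles_subset (S.isGreatest_abscissa hn hE hD))
  obtain ⟨x, hx⟩ := exists_fastSearchSet (S.exists_root_horizFun hE hD)
    (Set.finite_singleton z₀.im) z₀.re
  exact ⟨x, z₀, hz₀, hmax, hx⟩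

theorem exists_absStep (hE : IsUnit S.E) (hD : ‖S.D‖ < ε⁻¹) (x : ℝ) :
    ∃ x', S.AbsStep ε x x' :=
  exists_searchStep (S.exists_root_horizFun hE hD) (S.finite_vertMidpoints hE hD x) _ x

end Abscissa

end LTISystem

section RandomVisits

variable {Ω E : Type*} [MeasurableSpace Ω] {P : Measure Ω} [MeasurableSpace E] {ν : Measure E}
  {X : ℕ → Ω → E}

theorem ae_frequently_mem_of_iIndepFun (hX : ∀ k, Measurable (X k))
    (hlaw : ∀ k, P.map (X k) = ν) (hind : iIndepFun X P) {t : Set E} (ht : MeasurableSet t)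
    (hνt : ν t ≠ 0) : ∀ᵐ ω ∂P, ∃ᶠ k in atTop, X k ω ∈ t := by
  have hmeas : ∀ k, MeasurableSet (X k ⁻¹' t) := fun k => hX k ht
  have hindep : iIndepSet (fun k => X k ⁻¹' t) P := (iIndepSet_iff_meas_biInter hmeas).2 fun s =>
    hind.measure_inter_preimage_eq_mul s fun _ _ => ht
  have := hindep.isProbabilityMeasure
  have hsum : ∑' k, P (X k ⁻¹' t) = ⊤ := by
    simp only [← Measure.map_apply (hX _) ht, hlaw]
    exact ENNReal.tsum_const_eq_top_of_ne_zero hνt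
  have hlimsup := (mem_ae_iff_prob_eq_one (MeasurableSet.measurableSet_limsup hmeas)).2
    (measure_limsup_eq_one hmeas hindep hsum)
  filter_upwards [hlimsup] with ω hω using mem_limsup_iff_frequently_mem.1 hω

theorem ae_forall_mem_support_mapClusterPt [TopologicalSpace E] [SecondCountableTopology E]
    [OpensMeasurableSpace E]
    (hX : ∀ k, Measurable (X k)) (hlaw : ∀ k, P.map (X k) = ν) (hind : iIndepFun X P) :
    ∀ᵐ ω ∂P, ∀ x ∈ ν.support, MapClusterPt x atTop fun k => X k ω := by
  obtain ⟨B, hB, -, hbasis⟩ := TopologicalSpace.exists_countable_basis E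
  have hvisits : ∀ᵐ ω ∂P, ∀ U ∈ B, ν U ≠ 0 → ∃ᶠ k in atTop, X k ω ∈ U :=
    (ae_ball_iff hB).2 fun U hU => ae_all_iff.2 fun hνU =>
      ae_frequently_mem_of_iIndepFun hX hlaw hind (hbasis.isOpen hU).measurableSet hνU
  filter_upwards [hvisits] with ω hω x hx
  refine mapClusterPt_iff_frequently.2 fun V hV => ?_
  obtain ⟨U, hU, hxU, hUV⟩ := hbasis.mem_nhds_iff.1 hV
  have hpos := (Measure.mem_support_iff_forall x).1 hx U (hbasis.mem_nhds hU hxU)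
  exact (hω U hU hpos.ne').mono fun k hk => hUV hk

theorem Ico_subset_support_cond (a b : ℝ) :
    Set.Ico a b ⊆ (cond volume (Set.Ico a b)).support := fun x hx => by
  refine (Measure.mem_support_iff_forall x).2 fun U hU => ?_
  obtain ⟨c, hxc, hc⟩ := mem_nhdsGE_iff_exists_Ico_subset.1
    (mem_nhdsWithin_of_mem_nhds hU)
  have hsub : Set.Ico x (min b c) ⊆ Set.Ico a b ∩ U := fun y hy =>
    ⟨⟨hx.1.trans hy.1, hy.2.trans_le (min_le_left b c)⟩,
      hc ⟨hy.1, hy.2.trans_le (min_le_right b c)⟩⟩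
  have hvol : 0 < volume (Set.Ico a b ∩ U) := by
    refine lt_of_lt_of_le ?_ (measure_mono hsub)
    simpa using ⟨hx.2, hxc⟩
  rw [cond_apply measurableSet_Ico]
  exact ENNReal.mul_pos (by simp) hvol.ne'

end RandomVisits

theorem FastSearchSet.not_tendsto_of_eventually_pos {f : ℝ → ℝ → EReal} {η : ℕ → ℝ}
    {Θ : ℕ → Set ℝ} {x θ : ℝ} (hη : ∀ k, FastSearchSet f (η k) (Θ k) (η (k + 1)))
    (hpos : ∀ᶠ z : ℝ × ℝ in 𝓝 (x, θ), 0 < f z.2 z.1)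
    (hΘ : ∀ U ∈ 𝓝 θ, ∃ᶠ k in atTop, (Θ k ∩ U).Nonempty) : ¬ Tendsto η atTop (𝓝 x) := by
  intro hlim
  obtain ⟨p, hp, q, hq, hpq⟩ := eventually_prod_iff.1 (nhds_prod_eq (x := x) (y := θ) ▸ hpos)
  have hIcc := (hlim.Icc (hlim.comp (tendsto_add_atTop_nat 1))).eventually
    (eventually_smallSets_forall.2 hp)
  obtain ⟨k, ⟨ψ, hψ, hψq⟩, hk⟩ := ((hΘ _ hq).and_eventually hIcc).exists
  obtain ⟨t, ht, hnotpos⟩ := (hη k).exists_not_pos hψ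
  exact hnotpos (hpq (hk t ht) hψq)

namespace LTISystem

variable {n m p : ℕ} (S : LTISystem n m p) {z : ℂ} {ε : ℝ} {Λ : Set ℂ} {η : ℕ → ℝ}
  {q : ℕ} {φ : ℕ → Fin q → ℝ}

section Radius

theorem radFun_pos_iff {r θ : ℝ} : 0 < S.radFun ε θ r ↔ polarPt r θ ∈ S.superlevel ε⁻¹ :=
  EReal.sub_pos

theorem exists_root_radFun (hE : IsUnit S.E) (hD : ‖S.D‖ < ε⁻¹) (ψ x : ℝ)
    (h : 0 < S.radFun ε ψ x) : ∃ r, IsRootToTheRight (S.radFun ε ψ) x r := by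
  obtain ⟨M, hM⟩ := S.exists_forall_ntf_lt hE hD
  refine exists_isRootToTheRight ((S.hasAlgebraicLevels_circ hE).continuous_left ψ)
    (S.radFun_pos_iff.1 h) fun x (hx : M ≤ x) => (hM _ ?_).2
  rw [norm_polarPt]
  exact hx.trans (le_abs_self x)

theorem isGreatest_radius (hn : 0 < n) (hE : IsUnit S.E) (hD : ‖S.D‖ < ε⁻¹) :
    IsGreatest ((fun z : ℂ => ‖z‖) '' S.svs ε) (S.radius ε) :=
  S.isGreatest_sSup_image_svs hn hE hD continuous_norm

theorem le_radius_of_radFun_eq_zero (hn : 0 < n) (hE : IsUnit S.E) (hD : ‖S.D‖ < ε⁻¹)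
    (ψ r : ℝ) (h : S.radFun ε ψ r = 0) : r ≤ S.radius ε :=
  (le_abs_self r).trans ((S.isGreatest_radius hn hE hD).2
    ⟨polarPt r ψ, S.mem_svs_of_le_ntf hD (ereal_sub_coe_eq_zero_iff.1 h).ge, norm_polarPt r ψ⟩)

theorem periodic_mem_circEigs (ε r : ℝ) :
    Function.Periodic (· ∈ S.circEigs ε r) (2 * Real.pi) := fun θ =>
  congrArg (· ∈ pencilSpec (S.discS ε⁻¹ r) (S.discT ε⁻¹ r)) (periodic_exp_ofReal_mul_I θ)

theorem finite_circMidpoints (hD : ‖S.D‖ < ε⁻¹) (r : ℝ) : (S.circMidpoints ε r).Finite := by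
  rcases (S.circMidpoints ε r).eq_empty_or_nonempty with hempty | ⟨_, _, _, _, hcross, -⟩
  · simp [hempty]
  have hregular := hcross.midpoint_notMem
  rw [S.circEigs_eq_levelZeros hD] at hregular
  refine finite_setOf_crossSection_midpoint ?_ _
  refine Set.Finite.of_injOn (f := fun θ : ℝ => Complex.exp (θ * Complex.I)) (fun θ hθ => ?_)
    (fun θ hθ θ' hθ' h => ?_) (finite_isRoot_of_notMem_levelZeros hregular)
  · have hθ := hθ.1
    rwa [S.circEigs_eq_levelZeros hD, levelZeros_eq_preimage] at hθ
  · exact Circle.exp_injOn_Ico (a := 0) (by simp) hθ.2 hθ'.2 (Circle.ext h)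

theorem finite_radDirections (hD : ‖S.D‖ < ε⁻¹) (φ : Fin q → ℝ) (r : ℝ) :
    (S.radDirections ε φ r).Finite := by
  rw [radDirections]
  split_ifs
  · exact Set.finite_range φ
  · exact S.finite_circMidpoints hD r

theorem exists_add_zsmul_mem_circMidpoints {r a b : ℝ}
    (h : IsCrossSection (S.circEigs ε r) (fun θ => polarPt r θ ∈ S.svs ε) a b) :
    ∃ j : ℤ, (a + b) / 2 + j • (2 * Real.pi) ∈ S.circMidpoints ε r := by
  obtain ⟨j, hj, -⟩ := existsUnique_add_zsmul_mem_Ico Real.two_pi_pos a 0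
  rw [zero_add] at hj
  exact ⟨j, _, hj, _, h.add_const ((S.periodic_mem_circEigs ε r).zsmul j)
    (((periodic_polarPt r).comp (· ∈ S.svs ε)).zsmul j), by ring⟩

theorem nonempty_circEigs_inter_Icc {r : ℝ} (h : (S.circEigs ε r).Nonempty) (a : ℝ) :
    (S.circEigs ε r ∩ Set.Icc a (a + 2 * Real.pi)).Nonempty := by
  obtain ⟨θ, hθ⟩ := h
  obtain ⟨θ', hθ', heq⟩ :=
    (S.periodic_mem_circEigs ε r).exists_mem_Ico Real.two_pi_pos θ a
  exact ⟨θ', heq.mp hθ, Set.Ico_subset_Icc_self hθ'⟩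

theorem not_tendsto_norm_of_frequently_circMidpoints (hE : IsUnit S.E) (hD : ‖S.D‖ < ε⁻¹)
    {Θ : ℕ → Set ℝ} (hη : ∀ k, FastSearchSet (S.radFun ε) (η k) (Θ k) (η (k + 1)))
    (hΘ : ∃ᶠ k in atTop, (S.circMidpoints ε (η k)).Nonempty ∧ S.circMidpoints ε (η k) ⊆ Θ k)
    (hz : z ∈ S.superlevel ε⁻¹) : ¬ Tendsto η atTop (𝓝 ‖z‖) := fun hlim => by
  obtain ⟨θ₀, -, hθ₀⟩ := exists_mem_Ico_polarPt_norm z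
  rw [← hθ₀] at hz
  have hP := S.hasAlgebraicLevels_circ hE
  obtain ⟨δ, hδ, hbox⟩ := hP.exists_forall_mem_Icc_lt hz
  have hcross := hP.eventually_exists_isCrossSection_of_monotone ((norm_nonneg _).trans_lt hD)
    (monotone_nat_of_le_succ fun k => (hη k).le) hlim hδ hbox
    (θ₀ - δ - 2 * Real.pi) (θ₀ + δ + 2 * Real.pi)
  simp only [← S.circEigs_eq_levelZeros hD] at hcross
  obtain ⟨k, ⟨⟨_, _, _, _, hk, -⟩, hsub⟩, hcross⟩ := (hΘ.and_eventually hcross).exists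
  obtain ⟨c, d, hcd, hgt⟩ := hcross ⟨_, hk.midpoint_notMem⟩
    (by simpa using S.nonempty_circEigs_inter_Icc ⟨_, hk.1⟩ (θ₀ - δ - 2 * Real.pi))
    (S.nonempty_circEigs_inter_Icc ⟨_, hk.1⟩ (θ₀ + δ))
  obtain ⟨j, hj⟩ := S.exists_add_zsmul_mem_circMidpoints
    (hcd.mono fun θ => S.mem_svs_of_le_ntf hD)
  obtain ⟨t, ht, hnotpos⟩ := (hη k).exists_not_pos (hsub hj)
  refine hnotpos (S.radFun_pos_iff.2 ?_)
  rw [(periodic_polarPt t).zsmul j]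
  exact hgt t ht

theorem not_tendsto_norm_of_mapClusterPt (hE : IsUnit S.E)
    {Θ : ℕ → Set ℝ} (hη : ∀ k, FastSearchSet (S.radFun ε) (η k) (Θ k) (η (k + 1)))
    {ψ : ℕ → ℝ} (hψ : ∀ θ ∈ Set.Ico 0 (2 * Real.pi), MapClusterPt θ atTop ψ)
    (hΘ : ∀ᶠ k in atTop, ψ k ∈ Θ k) (hz : z ∈ S.superlevel ε⁻¹) :
    ¬ Tendsto η atTop (𝓝 ‖z‖) := by
  obtain ⟨θ, hθ, hpolar⟩ := exists_mem_Ico_polarPt_norm z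
  rw [← hpolar] at hz
  refine FastSearchSet.not_tendsto_of_eventually_pos (θ := θ) hη ?_ fun U hU =>
    ((mapClusterPt_iff_frequently.1 (hψ θ hθ) U hU).and_eventually hΘ).mono fun k hk =>
      ⟨ψ k, hk.2, hk.1⟩
  simp only [radFun_pos_iff]
  exact (S.hasAlgebraicLevels_circ hE).continuous_uncurry.continuousAt.eventually_const_lt hz

theorem not_tendsto_norm_of_mem_superlevel (hE : IsUnit S.E) (hD : ‖S.D‖ < ε⁻¹) {j : Fin q}
    (hφ : ∀ θ ∈ Set.Ico 0 (2 * Real.pi), MapClusterPt θ atTop fun k => φ k j)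
    (hη : ∀ k, FastSearchSet (S.radFun ε) (η k) (S.radDirections ε (φ k) (η k)) (η (k + 1)))
    (hz : z ∈ S.superlevel ε⁻¹) : ¬ Tendsto η atTop (𝓝 ‖z‖) := by
  by_cases harcs : ∃ᶠ k in atTop, (S.circMidpoints ε (η k)).Nonempty
  · refine S.not_tendsto_norm_of_frequently_circMidpoints hE hD hη (harcs.mono fun k hk => ?_) hz
    rw [radDirections, if_neg hk.ne_empty]
    exact ⟨hk, subset_rfl⟩
  · refine S.not_tendsto_norm_of_mapClusterPt hE hη hφ ?_ hz
    filter_upwards [not_frequently.1 harcs] with k hk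
    rw [radDirections, if_pos (Set.not_nonempty_iff_eq_empty.1 hk)]
    exact ⟨j, rfl⟩

variable {S} in
theorem IsRadRun.tendsto (hn : 0 < n) (hE : IsUnit S.E) (hD : ‖S.D‖ < ε⁻¹)
    (hΛ : S.IsSelection Λ) (hdom : S.DominatesOmitted ε Λ fun z => ‖z‖) {j : Fin q}
    (hφ : ∀ θ ∈ Set.Ico 0 (2 * Real.pi), MapClusterPt θ atTop fun k => φ k j)
    (hη : S.IsRadRun ε Λ φ η) : Tendsto η atTop (𝓝 (S.radius ε)) := by
  obtain ⟨⟨z₀, hz₀, hmax, hinit⟩, hstep⟩ := hη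
  have hL := S.isGreatest_radius hn hE hD
  have hroot := S.le_radius_of_radFun_eq_zero hn hE hD
  have hε : 0 ≤ ε := (inv_pos.1 ((norm_nonneg _).trans_lt hD)).le
  have hφ' : ∀ θ ∈ Set.Ico 0 (2 * Real.pi), MapClusterPt θ atTop fun k => φ (k + 1) j :=
    fun θ hθ => by
      have hcluster := hφ θ hθ
      rwa [MapClusterPt, ← map_add_atTop_eq_nat 1, map_map] at hcluster
  exact hdom.tendsto hE hD hΛ.poles_subset continuous_norm hL
    (fun w hw => (hmax w hw).trans hinit.le)
    (hinit.le_of_forall_root_le hroot (hL.2 ⟨z₀, S.eig_subset_svs hε (hΛ.1 hz₀), rfl⟩))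
    hstep hroot fun hfast z hz => S.not_tendsto_norm_of_mem_superlevel hE hD hφ' hfast hz

theorem exists_radInit (hn : 0 < n) (hE : IsUnit S.E) (hD : ‖S.D‖ < ε⁻¹)
    (hΛ : S.IsSelection Λ) (hdom : S.DominatesOmitted ε Λ fun z => ‖z‖) (φ : Fin q → ℝ) :
    ∃ x, S.RadInit ε Λ φ x := by
  obtain ⟨z₀, hz₀, hmax⟩ := Set.exists_max_image Λ (fun z => ‖z‖) ((S.finite_eig hE).subset hΛ.1)
    (hdom.nonempty hE hD hΛ.poles_subset (S.isGreatest_radius hn hE hD))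
  obtain ⟨x, hx⟩ := exists_fastSearchSet (S.exists_root_radFun hE hD)
    ((Set.finite_range φ).insert z₀.arg) ‖z₀‖
  exact ⟨x, z₀, hz₀, hmax, hx⟩

theorem exists_radStep (hE : IsUnit S.E) (hD : ‖S.D‖ < ε⁻¹) (φ : Fin q → ℝ) (x : ℝ) :
    ∃ x', S.RadStep ε φ x x' :=
  exists_searchStep (S.exists_root_radFun hE hD) (S.finite_radDirections hD φ x) _ x

theorem ae_tendsto_of_isRadRun (hn : 0 < n) (hE : IsUnit S.E) (hD : ‖S.D‖ < ε⁻¹)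
    (hΛ : S.IsSelection Λ) (hdom : S.DominatesOmitted ε Λ fun z => ‖z‖) (hq : 0 < q)
    {Ω : Type*} [MeasurableSpace Ω] {P : Measure Ω}
    {φ : ℕ → Fin q → Ω → ℝ} (hmeas : ∀ k j, Measurable (φ k j))
    (hunif : ∀ k j, pdf.IsUniform (φ k j) (Set.Ico 0 (2 * Real.pi)) P)
    (hind : iIndepFun (fun kj : ℕ × Fin q => φ kj.1 kj.2) P) :
    ∀ᵐ ω ∂P, ∀ η : ℕ → ℝ, S.IsRadRun ε Λ (fun k j => φ k j ω) η →
      Tendsto η atTop (𝓝 (S.radius ε)) := by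
  have hind₀ : iIndepFun (fun k => φ k ⟨0, hq⟩) P :=
    hind.precomp (g := fun k => (k, ⟨0, hq⟩)) fun k l h => congrArg Prod.fst h
  filter_upwards [ae_forall_mem_support_mapClusterPt (fun k => hmeas k _) (fun k => hunif k _)
    hind₀] with ω hω η hη
  exact hη.tendsto hn hE hD hΛ hdom fun θ hθ => hω θ (Ico_subset_support_cond _ _ hθ)

end Radius

end LTISystem

theorem mainTheorem2 {n m p : ℕ} (hn : 0 < n) (S : LTISystem n m p) (hE : IsUnit S.E)
    (ε : ℝ) (hε : 0 < ε) (hD : ε * ‖S.D‖ < 1) (Λ : Set ℂ) (hΛ : S.IsSelection Λ) :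
    (IsGreatest (Complex.re '' S.svs ε) (S.abscissa ε) ∧
      ((∀ z ∈ S.eig, z ∉ Λ → IsIsolatedPoint (S.svs ε) z →
          ∃ w ∈ S.svs ε, (w ∈ Λ ∨ ¬ IsIsolatedPoint (S.svs ε) w) ∧ z.re ≤ w.re) →
        (∃ x, S.AbsInit ε Λ x) ∧
        (∀ x, ∃ x', S.AbsStep ε x x') ∧
        ∀ η : ℕ → ℝ, S.IsAbsRun ε Λ η → Tendsto η atTop (𝓝 (S.abscissa ε)))) ∧
    (IsGreatest ((fun z : ℂ => ‖z‖) '' S.svs ε) (S.radius ε) ∧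
      ((∀ z ∈ S.eig, z ∉ Λ → IsIsolatedPoint (S.svs ε) z →
          ∃ w ∈ S.svs ε, (w ∈ Λ ∨ ¬ IsIsolatedPoint (S.svs ε) w) ∧ ‖z‖ ≤ ‖w‖) →
        ∀ (q : ℕ), 0 < q →
        (∀ φ : Fin q → ℝ, ∃ x, S.RadInit ε Λ φ x) ∧
        (∀ (φ : Fin q → ℝ) (x : ℝ), ∃ x', S.RadStep ε φ x x') ∧
        ∀ (Ω : Type*) [MeasurableSpace Ω] (P : Measure Ω) [IsProbabilityMeasure P]
          (φ : ℕ → Fin q → Ω → ℝ),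
          (∀ k j, Measurable (φ k j)) →
          (∀ k j, pdf.IsUniform (φ k j) (Set.Ico 0 (2 * Real.pi)) P) →
          iIndepFun (fun kj : ℕ × Fin q => φ kj.1 kj.2) P →
          ∀ᵐ ω ∂P, ∀ η : ℕ → ℝ, S.IsRadRun ε Λ (fun k j => φ k j ω) η →
            Tendsto η atTop (𝓝 (S.radius ε)))) := by
  have hD' : ‖S.D‖ < ε⁻¹ := by
    rw [← mul_one ε⁻¹]
    exact (lt_inv_mul_iff₀ hε).2 hD
  refine ⟨⟨S.isGreatest_abscissa hn hE hD', fun hdom => ⟨?_, ?_, ?_⟩⟩,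
    S.isGreatest_radius hn hE hD', fun hdom q hq => ⟨?_, ?_, ?_⟩⟩
  · exact S.exists_absInit hn hE hD' hΛ hdom
  · exact S.exists_absStep hE hD'
  · exact fun η hη => hη.tendsto hn hE hD' hΛ hdom
  · exact S.exists_radInit hn hE hD' hΛ hdom
  · exact S.exists_radStep hE hD'
  · exact fun Ω _ P _ φ hmeas hunif hind =>
      S.ae_tendsto_of_isRadRun hn hE hD' hΛ hdom hq hmeas hunif hind
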